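/- All systems $A,D,E,F,A',D',E'$ are finite-dimensional, $\mathcal{S}(X)$ is the set of density operators on $X$, $\log$ is the natural logarithm, and $D(\gamma\|\rho)=\mathrm{tr}[\gamma(\log\gamma-\log\rho)]$ if the support of $\gamma$ is contained in that of $\rho$, and $D(\gamma\|\rho)=+\infty$ otherwise. For $\rho_{AD}\in\mathcal{S}(AD)$ and $\sigma_{AE}\in\mathcal{S}(AE)$, the argument flipped relative entropy of recovery is $$\bar D^{\mathrm{rec}}(\sigma_{AE}\|\rho_{AD}):=\inf_{\Gamma_{E\to D}}D\big((\mathcal{I}_A\otimes\Gamma_{E\to D})(\sigma_{AE})\,\big\|\,\rho_{AD}\big)\in[0,+\infty],$$ where the infimum is over all trace-preserving completely positive maps $\Gamma_{E\to D}$. Let $\rho_{AD}\in\mathcal{S}(AD)$ and $\sigma_{AE}\in\mathcal{S}(AE)$ with $\rho_A>0$. Then the infimum in $\bar D^{\mathrm{rec}}(\sigma_{AE}\|\rho_{AD})$ is a minimum, and for every purification $\sigma_{AEF}$ of $\sigma_{AE}$, $$\bar D^{\mathrm{rec}}(\sigma_{AE}\|\rho_{AD})=\sup\big\{-\mathrm{tr}[S_{AF}\sigma_{AF}]\;:\;R_{AD}>0,\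 S_{AF}=S_{AF}^\dagger,\ 1_D\otimes S_{AF}\ge(\log\rho_{AD}-\log R_{AD})\otimes 1_F,\ \mathrm{tr}[R_{AD}]=1\big\}.$$ If $\rho_{AD}$ is singular, then $\log\rho_{AD}$ is understood as $-\infty$ on the kernel of $\rho_{AD}$, that is, the operator inequality is required for the quadratic forms at the vectors of $\mathrm{supp}(\rho_{AD})\otimes F$; both sides of the identity may be $+\infty$ in this case. Moreover, for all $\tau_{A'D'}\in\mathcal{S}(A'D')$ with $\tau_{A'}>0$ and $\omega_{A'E'}\in\mathcal{S}(A'E')$, $$\bar D^{\mathrm{rec}}(\sigma_{AE}\otimes\omega_{A'E'}\|\rho_{AD}\otimes\tau_{A'D'})=\bar D^{\mathrm{rec}}(\sigma_{AE}\|\rho_{AD})+\bar D^{\mathrm{rec}}(\omega_{A'E'}\|\tau_{A'D'}).$$ -/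

import Mathlib

open scoped Kronecker ComplexOrder

namespace QRec

noncomputable section

/-- Density operators of a finite quantum system with orthonormal basis `X`. -/
def IsState {X : Type*} [Fintype X] (ρ : Matrix X X ℂ) : Prop :=
  ρ.PosSemidef ∧ ρ.trace = 1

/-- The partial trace over the second tensor factor. -/
def ptraceRight {X Y : Type*} [Fintype Y] (M : Matrix (X × Y) (X × Y) ℂ) : Matrix X X ℂ :=
  Matrix.of fun x x' => ∑ y, M (x, y) (x', y)

/-- The map `I ⊗ Γ`, where `I` is the identity map on the operators on `X`. -/
def applyRight {X E D : Type*} (Γ : Matrix E E ℂ →ₗ[ℂ] Matrix D D ℂ)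
    (M : Matrix (X × E) (X × E) ℂ) : Matrix (X × D) (X × D) ℂ :=
  Matrix.of fun p q => Γ (Matrix.of fun e e' => M (p.1, e) (q.1, e')) p.2 q.2

/-- Trace-preserving completely positive maps from `E` to `D`. -/
def IsChannel {E D : Type*} [Fintype E] [Fintype D]
    (Γ : Matrix E E ℂ →ₗ[ℂ] Matrix D D ℂ) : Prop :=
  (∀ (n : ℕ) (M : Matrix (Fin n × E) (Fin n × E) ℂ), M.PosSemidef → (applyRight Γ M).PosSemidef) ∧
    ∀ X : Matrix E E ℂ, (Γ X).trace = X.trace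

/-- The support of a positive semidefinite operator (the orthogonal complement of its kernel),
which is its range. -/
def supp {X : Type*} [Fintype X] (ρ : Matrix X X ℂ) : Submodule ℂ (X → ℂ) :=
  LinearMap.range ρ.mulVecLin

/-- The natural logarithm of a positive semidefinite operator by functional calculus. As
`Real.log 0 = 0`, this is the logarithm on the support, extended by `0` to the kernel; where it is
used for a singular operator below, only its values on the support matter. -/
def mlog {X : Type*} [Fintype X] [DecidableEq X] (ρ : Matrix X X ℂ) : Matrix X X ℂ :=
  cfc Real.log ρ

open Classical in
/-- Umegaki's relative entropy `D(γ‖ρ)`, which is `+∞` unless the support of `γ` is contained in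
the support of `ρ`. -/
def relEntropy {X : Type*} [Fintype X] [DecidableEq X] (γ ρ : Matrix X X ℂ) : EReal :=
  if supp γ ≤ supp ρ then (((γ * (mlog γ - mlog ρ)).trace.re : ℝ) : EReal) else ⊤

/-- The argument flipped relative entropy of recovery: the infimum of
`D((I_A ⊗ Γ)(σ_AE) ‖ ρ_AD)` over all channels `Γ` from `E` to `D`. -/
def flippedRec {A D E : Type*} [Fintype A] [Fintype D] [Fintype E] [DecidableEq A] [DecidableEq D]
    (σ : Matrix (A × E) (A × E) ℂ) (ρ : Matrix (A × D) (A × D) ℂ) : EReal :=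
  ⨅ (Γ : Matrix E E ℂ →ₗ[ℂ] Matrix D D ℂ) (_ : IsChannel Γ), relEntropy (applyRight Γ σ) ρ

/-- The rank-one operator `|ψ⟩⟨ψ|`. -/
def pureState {X : Type*} (ψ : X → ℂ) : Matrix X X ℂ :=
  Matrix.vecMulVec ψ (star ψ)

/-- The vector `ψ` on `AEF` purifies `σ_AE`. -/
def IsPurification {A E F : Type*} [Fintype F] (ψ : (A × E) × F → ℂ)
    (σ : Matrix (A × E) (A × E) ℂ) : Prop :=
  ptraceRight (pureState ψ) = σ

/-- The marginal on `AF` of the pure state `ψ` on `AEF`. -/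
def marginalAF {A E F : Type*} [Fintype E] (ψ : (A × E) × F → ℂ) :
    Matrix (A × F) (A × F) ℂ :=
  Matrix.of fun p q => ∑ e, pureState ψ ((p.1, e), p.2) ((q.1, e), q.2)

/-- The operator `1_D ⊗ S_AF` on `ADF`. -/
def oneTensor {A D F : Type*} [DecidableEq D] (S : Matrix (A × F) (A × F) ℂ) :
    Matrix ((A × D) × F) ((A × D) × F) ℂ :=
  Matrix.of fun x y => if x.1.2 = y.1.2 then S (x.1.1, x.2) (y.1.1, y.2) else 0

/-- The operator inequality `1_D ⊗ S_AF ≥ (log ρ_AD - log R_AD) ⊗ 1_F` for Hermitian `S_AF`,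
positive definite `R_AD` and positive semidefinite `ρ_AD`, as an inequality of quadratic forms. The
form of `log ρ_AD` takes the value `-∞` at vectors outside the support of `ρ_AD`, so that the
inequality has content only at the vectors of `supp ρ_AD ⊗ F`, which are those `v` whose components
`v(·, f)` all lie in `supp ρ_AD`. -/
def DualConstraint {A D F : Type*} [Fintype A] [Fintype D] [Fintype F]
    [DecidableEq A] [DecidableEq D] [DecidableEq F]
    (ρ R : Matrix (A × D) (A × D) ℂ) (S : Matrix (A × F) (A × F) ℂ) : Prop :=
  ∀ v : (A × D) × F → ℂ, (∀ f, (fun x => v (x, f)) ∈ supp ρ) →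
    (star v ⬝ᵥ (((mlog ρ - mlog R) ⊗ₖ (1 : Matrix F F ℂ)).mulVec v)).re
      ≤ (star v ⬝ᵥ ((oneTensor (D := D) S).mulVec v)).re

/-- For invertible `ρ_AD` the constraint is the usual operator inequality. -/
theorem dualConstraint_iff_of_posDef {A D F : Type*} [Fintype A] [Fintype D] [Fintype F]
    [DecidableEq A] [DecidableEq D] [DecidableEq F]
    {ρ R : Matrix (A × D) (A × D) ℂ} {S : Matrix (A × F) (A × F) ℂ}
    (hρ : ρ.PosDef) (hS : S.IsHermitian) :
    DualConstraint ρ R S ↔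
      (oneTensor S - (mlog ρ - mlog R) ⊗ₖ (1 : Matrix F F ℂ)).PosSemidef := by
  have hsupp : ∀ w, w ∈ supp ρ := fun w => by
    refine ⟨ρ⁻¹.mulVec w, ?_⟩
    simp [Matrix.mulVec_mulVec, Matrix.mul_nonsing_inv _ ((Matrix.isUnit_iff_isUnit_det _).1 hρ.isUnit)]
  have h1 : (oneTensor (D := D) S).IsHermitian := by
    ext x y
    have := hS.apply (x.1.1, x.2) (y.1.1, y.2)
    by_cases h : x.1.2 = y.1.2
    · simpa [oneTensor, h] using this
    · simp [oneTensor, h, Ne.symm h]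
  have h2 : ((mlog ρ - mlog R) ⊗ₖ (1 : Matrix F F ℂ)).IsHermitian := by
    have hl : ∀ M : Matrix (A × D) (A × D) ℂ, (mlog M).IsHermitian :=
      fun M => (cfc_predicate Real.log M)
    rw [Matrix.IsHermitian, Matrix.conjTranspose_kronecker, ((hl ρ).sub (hl R)).eq,
      Matrix.conjTranspose_one]
  rw [Matrix.posSemidef_iff_dotProduct_mulVec]
  constructor
  · refine fun h => ⟨h1.sub h2, fun v => ?_⟩
    have hi := (h1.sub h2).im_star_dotProduct_mulVec_self v
    have hv := h v fun f => hsupp _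
    rw [Complex.le_def]
    refine ⟨?_, by simpa using hi.symm⟩
    simp only [Matrix.sub_mulVec, dotProduct_sub, Complex.sub_re, Complex.zero_re] at hv ⊢
    linarith
  · intro h v _
    have hv := (Complex.le_def.1 (h.2 v)).1
    simp only [Matrix.sub_mulVec, dotProduct_sub, Complex.sub_re, Complex.zero_re] at hv ⊢
    linarith

/-- The objective values `-tr[S_AF σ_AF]` of all feasible pairs `(R_AD, S_AF)`. -/
def dualValues {A D F : Type*} [Fintype A] [Fintype D] [Fintype F]
    [DecidableEq A] [DecidableEq D] [DecidableEq F]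
    (σAF : Matrix (A × F) (A × F) ℂ) (ρ : Matrix (A × D) (A × D) ℂ) : Set EReal :=
  {x | ∃ (R : Matrix (A × D) (A × D) ℂ) (S : Matrix (A × F) (A × F) ℂ),
    R.PosDef ∧ S.IsHermitian ∧ DualConstraint ρ R S ∧ R.trace = 1 ∧
      x = ((-(S * σAF).trace.re : ℝ) : EReal)}

/-- The tensor product of an operator on `AD` and an operator on `A'D'`, as an operator on the
bipartite system with parts `AA'` and `DD'`. -/
def tensor {A D A' D' : Type*} (M : Matrix (A × D) (A × D) ℂ)
    (N : Matrix (A' × D') (A' × D') ℂ) :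
    Matrix ((A × A') × (D × D')) ((A × A') × (D × D')) ℂ :=
  (M ⊗ₖ N).submatrix (Equiv.prodProdProdComm A A' D D') (Equiv.prodProdProdComm A A' D D')

end

end QRec

namespace QRec

open Matrix

noncomputable section

set_option linter.unusedSectionVars false

/-! ### Functional calculus, Klein's inequality and support projections -/

section Spectral

variable {n m : Type*} [Fintype n] [DecidableEq n] [Fintype m] [DecidableEq m]

/-! Fix a purification of `σ_AE`. By a Stinespring-type correspondence, the operators obtained from
`σ_AE` by channels from `E` to `D` are exactly the `AD`-marginals of positive extensions `γ_ADF` of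
`σ_AF` (`IsChannel.exists_extension`, `exists_isChannel`). So the recovery quantity equals
`extensionRec`, a minimization over a compact convex set (`flippedRec_eq_extensionRec`). On the
extensions supported on `supp ρ` the objective is finite and continuous, so a minimum exists. If
there are none, every value is `+∞`.

Weak duality is Klein's inequality: `D(γ_AD‖R) ≥ 0` gives `D(γ_AD‖ρ) ≥ tr[γ_AD (log R - log ρ)]`,
and the constraint bounds this below by `-tr[S σ_AF]`.

For strong duality, the optimal `R` should be the marginal of the minimizer, but that may be
singular. Therefore the objective is minimized with `X + ε1` in the entropy term, and `R` is the
normalized `X + ε1`. First-order optimality shows that this one `R` makes `tr[γ_AD (log R - log ρ)]`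
large for all extensions simultaneously (`exists_posDef_forall_lt`). With `R` fixed the problem is
linear in `γ`, and Hahn–Banach separation supplies `S` (`exists_dual_feasible`).

Additivity has one inequality from each side of the duality: tensor products of minimizers give `≤`,
and the dual pairs `(R ⊗ R', S ⊗ 1 + 1 ⊗ S')` give `≥` (`DualConstraint.tensor`,
`extensionRec_tensor`). -/

theorem aeval_conj {U : Matrix n m ℂ} {V : Matrix m n ℂ} (h : V * U = 1) (h' : U * V = 1)
    (X : Matrix m m ℂ) (p : Polynomial ℝ) :
    Polynomial.aeval (U * X * V) p = U * Polynomial.aeval X p * V := by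
  have hpow : ∀ k : ℕ, (U * X * V) ^ k = U * X ^ k * V := by
    intro k
    induction k with
    | zero => simp [h']
    | succ k ih =>
      rw [pow_succ, ih, pow_succ]
      calc U * X ^ k * V * (U * X * V) = U * X ^ k * (V * U) * X * V := by
            simp only [Matrix.mul_assoc]
        _ = _ := by rw [h]; simp only [Matrix.mul_assoc, Matrix.one_mul]
  induction p using Polynomial.induction_on' with
  | add p q hp hq => simp [hp, hq, Matrix.mul_add, Matrix.add_mul]
  | monomial k a =>
    simp [Polynomial.aeval_monomial, hpow, Algebra.algebraMap_eq_smul_one]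

theorem aeval_diagonal (d : m → ℝ) (p : Polynomial ℝ) :
    Polynomial.aeval (diagonal fun i => (d i : ℂ)) p = diagonal fun i => ((p.eval (d i) : ℝ) : ℂ) := by
  induction p using Polynomial.induction_on' with
  | add p q hp hq => simp [hp, hq, diagonal_add]
  | monomial k a =>
    ext i j
    by_cases hij : i = j
    · subst hij
      simp [Polynomial.aeval_monomial, diagonal_pow, Algebra.algebraMap_eq_smul_one]
    · simp [Polynomial.aeval_monomial, diagonal_pow, Algebra.algebraMap_eq_smul_one, hij]

theorem isHermitian_conj_diagonal (U : Matrix n m ℂ) (d : m → ℝ) :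
    (U * (diagonal fun i => (d i : ℂ)) * Uᴴ).IsHermitian := by
  refine isHermitian_mul_mul_conjTranspose U ?_
  rw [IsHermitian, diagonal_conjTranspose]
  congr 1
  ext i
  simp

/-- The functional calculus of a matrix given in diagonal form. -/
theorem cfc_conj_diagonal {U : Matrix n m ℂ} (h : Uᴴ * U = 1) (h' : U * Uᴴ = 1) (d : m → ℝ)
    (f : ℝ → ℝ) :
    cfc f (U * (diagonal fun i => (d i : ℂ)) * Uᴴ)
      = U * (diagonal fun i => (f (d i) : ℂ)) * Uᴴ := by
  set M := U * (diagonal fun i => (d i : ℂ)) * Uᴴ with hM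
  have hMs : IsSelfAdjoint M := isHermitian_conj_diagonal U d
  have hfin : (spectrum ℝ M).Finite := Matrix.finite_real_spectrum
  -- Interpolating on the spectrum and on the entries of `d` together avoids having to identify the
  -- two sets.
  set s : Finset ℝ := hfin.toFinset ∪ Finset.univ.image d
  set p := Lagrange.interpolate s id f
  have hp : ∀ x ∈ s, p.eval x = f x := fun x hx =>
    Lagrange.eval_interpolate_at_node (v := id) f Function.injective_id.injOn hx
  have h1 : cfc f M = cfc p.eval M := by
    refine cfc_congr fun x hx => (hp x ?_).symm
    simp [s, hx]
  rw [h1, cfc_polynomial p M hMs, hM, aeval_conj h h', aeval_diagonal]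
  congr 3
  ext i
  rw [hp]
  simp [s]

theorem exists_diagonalization {X : Matrix n n ℂ} (hX : X.IsHermitian) :
    ∃ U : Matrix n n ℂ, Uᴴ * U = 1 ∧ U * Uᴴ = 1 ∧
      X = U * (diagonal fun i => (hX.eigenvalues i : ℂ)) * Uᴴ := by
  refine ⟨hX.eigenvectorUnitary, ?_, ?_, ?_⟩
  · exact Unitary.coe_star_mul_self hX.eigenvectorUnitary
  · exact Unitary.coe_mul_star_self hX.eigenvectorUnitary
  · conv_lhs => rw [hX.spectral_theorem, Unitary.conjStarAlgAut_apply]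
    rfl

theorem cfc_mul_cfc (X : Matrix n n ℂ) (f g : ℝ → ℝ) :
    cfc f X * cfc g X = cfc (fun x => f x * g x) X :=
  (cfc_mul f g X (Matrix.finite_real_spectrum.continuousOn f)
    (Matrix.finite_real_spectrum.continuousOn g)).symm

theorem mul_cfc {X : Matrix n n ℂ} (hX : X.IsHermitian) (f : ℝ → ℝ) :
    X * cfc f X = cfc (fun x => x * f x) X := by
  rw [← cfc_mul_cfc, cfc_id' ℝ X hX.isSelfAdjoint]

theorem cfc_mul {X : Matrix n n ℂ} (hX : X.IsHermitian) (f : ℝ → ℝ) :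
    cfc f X * X = cfc (fun x => f x * x) X := by
  rw [← cfc_mul_cfc, cfc_id' ℝ X hX.isSelfAdjoint]

theorem isHermitian_cfc (X : Matrix n n ℂ) (f : ℝ → ℝ) : (cfc f X).IsHermitian :=
  cfc_predicate f X

/-- The trace of a product of functions of two Hermitian matrices in terms of the overlaps of
their eigenvectors. -/
theorem exists_overlap {X Y : Matrix n n ℂ} (hX : X.IsHermitian) (hY : Y.IsHermitian) :
    ∃ c : n → n → ℝ, (∀ i j, 0 ≤ c i j) ∧ ∀ f g : ℝ → ℝ, (cfc f X * cfc g Y).trace.re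
      = ∑ i, ∑ j, c i j * (f (hX.eigenvalues i) * g (hY.eigenvalues j)) := by
  obtain ⟨U, hU, hU', hXU⟩ := exists_diagonalization hX
  obtain ⟨V, hV, hV', hYV⟩ := exists_diagonalization hY
  refine ⟨fun i j => Complex.normSq ((Uᴴ * V) i j), fun i j => Complex.normSq_nonneg _,
    fun f g => ?_⟩
  have hf : cfc f X = U * (diagonal fun i => (f (hX.eigenvalues i) : ℂ)) * Uᴴ := by
    conv_lhs => rw [hXU, cfc_conj_diagonal hU hU']
  have hg : cfc g Y = V * (diagonal fun i => (g (hY.eigenvalues i) : ℂ)) * Vᴴ := by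
    conv_lhs => rw [hYV, cfc_conj_diagonal hV hV']
  have h1 : (cfc f X * cfc g Y).trace
      = ((diagonal fun i => (f (hX.eigenvalues i) : ℂ)) * ((Uᴴ * V) *
        (diagonal fun i => (g (hY.eigenvalues i) : ℂ)) * (Uᴴ * V)ᴴ)).trace := by
    rw [hf, hg, conjTranspose_mul, conjTranspose_conjTranspose, Matrix.mul_assoc U, Matrix.mul_assoc U,
      Matrix.trace_mul_comm U]
    simp only [Matrix.mul_assoc]
  rw [h1]
  generalize Uᴴ * V = W
  simp only [trace, diag_apply, diagonal_mul, Matrix.mul_apply (M := W * _), mul_diagonal,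
    Complex.re_sum, Finset.mul_sum, conjTranspose_apply]
  refine Finset.sum_congr rfl fun i _ => Finset.sum_congr rfl fun j _ => ?_
  have : (f (hX.eigenvalues i) : ℂ) * (W i j * (g (hY.eigenvalues j) : ℂ) * star (W i j))
      = ((Complex.normSq (W i j) * (f (hX.eigenvalues i) * g (hY.eigenvalues j)) : ℝ) : ℂ) := by
    push_cast
    rw [← Complex.mul_conj, starRingEnd_apply]
    ring
  rw [this, Complex.ofReal_re]

theorem sub_le_mul_log_sub {p q : ℝ} (hp : 0 ≤ p) (hq : 0 < q) :
    p - q ≤ p * Real.log p - p * Real.log q := by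
  rcases hp.eq_or_lt with rfl | hp
  · simpa using hq.le
  · have h := Real.log_le_sub_one_of_pos (div_pos hq hp)
    rw [Real.log_div hq.ne' hp.ne'] at h
    have h2 := mul_le_mul_of_nonneg_left h hp.le
    have h3 : p * (q / p - 1) = q - p := by field_simp
    rw [h3] at h2
    linarith

theorem mul_mlog {X : Matrix n n ℂ} (hX : X.IsHermitian) :
    X * mlog X = cfc (fun x => x * Real.log x) X :=
  mul_cfc hX _

/-- Klein's inequality. -/
theorem klein {X Y : Matrix n n ℂ} (hX : X.PosSemidef) (hY : Y.PosDef) :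
    X.trace.re - Y.trace.re ≤ (X * (mlog X - mlog Y)).trace.re := by
  obtain ⟨c, hc, hfg⟩ := exists_overlap hX.isHermitian hY.isHermitian
  have hXs : IsSelfAdjoint X := hX.isHermitian
  have hYs : IsSelfAdjoint Y := hY.isHermitian
  -- All four traces are expanded in the same overlaps, so the claim reduces to `sub_le_mul_log_sub`
  -- for each pair of eigenvalues.
  have h1 := hfg (fun x => x) (fun _ => 1)
  have h2 := hfg (fun _ => 1) (fun x => x)
  have h3 := hfg (fun x => x * Real.log x) (fun _ => 1)
  have h4 := hfg (fun x => x) Real.log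
  rw [cfc_id' ℝ X hXs, cfc_const_one ℝ Y hYs, Matrix.mul_one] at h1
  rw [cfc_id' ℝ Y hYs, cfc_const_one ℝ X hXs, Matrix.one_mul] at h2
  rw [cfc_const_one ℝ Y hYs, Matrix.mul_one, ← mul_mlog hXs] at h3
  rw [cfc_id' ℝ X hXs] at h4
  change (X * mlog Y).trace.re = _ at h4
  rw [Matrix.mul_sub, trace_sub, Complex.sub_re, h1, h2, h3, h4]
  simp only [← Finset.sum_sub_distrib, ← mul_sub]
  refine Finset.sum_le_sum fun i _ => Finset.sum_le_sum fun j _ =>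
    mul_le_mul_of_nonneg_left ?_ (hc i j)
  simpa using sub_le_mul_log_sub (hX.eigenvalues_nonneg i) (hY.eigenvalues_pos j)

theorem trace_conj_diagonal {U : Matrix n m ℂ} (h : Uᴴ * U = 1) (d : m → ℝ) :
    (U * (diagonal fun i => (d i : ℂ)) * Uᴴ).trace.re = ∑ i, d i := by
  rw [Matrix.trace_mul_comm, ← Matrix.mul_assoc, h, Matrix.one_mul, trace_diagonal, Complex.re_sum]
  simp

theorem conj_diagonal_mul {U : Matrix n m ℂ} (h : Uᴴ * U = 1) (d e : m → ℂ) :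
    (U * diagonal d * Uᴴ) * (U * diagonal e * Uᴴ) = U * (diagonal fun i => d i * e i) * Uᴴ := by
  rw [← diagonal_mul_diagonal]
  calc _ = U * diagonal d * (Uᴴ * U) * diagonal e * Uᴴ := by simp only [Matrix.mul_assoc]
    _ = _ := by rw [h]; simp only [Matrix.mul_assoc, Matrix.one_mul]

theorem add_smul_one_eq {U : Matrix n m ℂ} (h' : U * Uᴴ = 1) (d : m → ℝ) (ε : ℝ) :
    U * (diagonal fun i => (d i : ℂ)) * Uᴴ + (ε : ℂ) • 1
      = U * (diagonal fun i => ((d i + ε : ℝ) : ℂ)) * Uᴴ := by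
  have : (diagonal fun i : m => ((d i + ε : ℝ) : ℂ))
      = (diagonal fun i => (d i : ℂ)) + (ε : ℂ) • (1 : Matrix m m ℂ) := by
    ext i j
    by_cases hij : i = j <;> simp [hij]
  rw [this, Matrix.mul_add, Matrix.add_mul]
  simp [h']

/-- Both logarithms are diagonal in the eigenbasis of `X`, where monotonicity of `log` applies; zero
eigenvalues contribute nothing on either side. This removes the shift by `ε` at the end of the
strong duality argument. -/
theorem trace_mul_mlog_le {X : Matrix n n ℂ} (hX : X.PosSemidef) {ε : ℝ} (hε : 0 ≤ ε) :
    (X * mlog X).trace.re ≤ (X * mlog (X + (ε : ℂ) • 1)).trace.re := by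
  obtain ⟨U, hU, hU', hXU⟩ := exists_diagonalization hX.isHermitian
  set d := hX.isHermitian.eigenvalues
  have hd : ∀ i, 0 ≤ d i := hX.eigenvalues_nonneg
  rw [hXU, add_smul_one_eq hU', mlog, mlog, cfc_conj_diagonal hU hU', cfc_conj_diagonal hU hU',
    conj_diagonal_mul hU, conj_diagonal_mul hU]
  simp only [← Complex.ofReal_mul]
  rw [trace_conj_diagonal hU, trace_conj_diagonal hU]
  refine Finset.sum_le_sum fun i _ => ?_
  rcases (hd i).eq_or_lt with h | h
  · simp [← h]
  · exact mul_le_mul_of_nonneg_left (Real.log_le_log h (by linarith)) h.le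

/-- Turns the normalization of the dual operator `R` into an additive constant. -/
theorem mlog_smul {X : Matrix n n ℂ} (hX : X.PosDef) {r : ℝ} (hr : 0 < r) :
    mlog ((r : ℂ) • X) = mlog X + ((Real.log r : ℝ) : ℂ) • 1 := by
  obtain ⟨U, hU, hU', hXU⟩ := exists_diagonalization hX.isHermitian
  set d := hX.isHermitian.eigenvalues
  have hd : ∀ i, 0 < d i := hX.eigenvalues_pos
  have h1 : (r : ℂ) • (U * (diagonal fun i => (d i : ℂ)) * Uᴴ)
      = U * (diagonal fun i => ((r * d i : ℝ) : ℂ)) * Uᴴ := by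
    rw [← Matrix.smul_mul, ← Matrix.mul_smul, ← diagonal_smul]
    congr 3
    ext i
    simp
  rw [hXU, h1, mlog, mlog, cfc_conj_diagonal hU hU', cfc_conj_diagonal hU hU', add_smul_one_eq hU']
  congr 3
  ext i
  rw [Real.log_mul hr.ne' (hd i).ne', add_comm]

/-- The orthogonal projection onto the support of a Hermitian matrix. -/
def suppProj (X : Matrix n n ℂ) : Matrix n n ℂ := cfc (fun x : ℝ => if x = 0 then 0 else 1) X

theorem isHermitian_suppProj (X : Matrix n n ℂ) : (suppProj X).IsHermitian := isHermitian_cfc _ _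

theorem suppProj_mul_self (X : Matrix n n ℂ) : suppProj X * suppProj X = suppProj X := by
  rw [suppProj, cfc_mul_cfc]
  congr 1
  ext x
  split_ifs <;> simp

theorem suppProj_mul {X : Matrix n n ℂ} (hX : X.IsHermitian) : suppProj X * X = X := by
  rw [suppProj, cfc_mul hX]
  conv_rhs => rw [← cfc_id' ℝ X hX.isSelfAdjoint]
  congr 1
  ext x
  split_ifs with h <;> simp [h]

theorem mul_suppProj {X : Matrix n n ℂ} (hX : X.IsHermitian) : X * suppProj X = X := by
  have := congrArg conjTranspose (suppProj_mul hX)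
  rwa [conjTranspose_mul, hX.eq, (isHermitian_suppProj X).eq] at this

/-- Since `0⁻¹ = 0`, the functional calculus of inversion is the pseudoinverse. -/
theorem mul_cfc_inv {X : Matrix n n ℂ} (hX : X.IsHermitian) :
    X * cfc (fun x : ℝ => x⁻¹) X = suppProj X := by
  rw [suppProj, mul_cfc hX]
  congr 1
  ext x
  split_ifs with h <;> simp [h]

theorem cfc_inv_mul {X : Matrix n n ℂ} (hX : X.IsHermitian) :
    cfc (fun x : ℝ => x⁻¹) X * X = suppProj X := by
  have := congrArg conjTranspose (mul_cfc_inv hX)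
  rwa [conjTranspose_mul, hX.eq, (isHermitian_suppProj X).eq, (isHermitian_cfc _ _).eq] at this

theorem mlog_mul_suppProj (X : Matrix n n ℂ) : mlog X * suppProj X = mlog X := by
  rw [mlog, suppProj, cfc_mul_cfc]
  congr 1
  ext x
  split_ifs with h <;> simp [h]

theorem suppProj_eq_one {X : Matrix n n ℂ} (hX : X.PosDef) : suppProj X = 1 := by
  have h := suppProj_mul hX.isHermitian
  have hu := hX.isUnit
  exact hu.mul_right_cancel (by rw [h, one_mul])

theorem mem_supp_iff {X : Matrix n n ℂ} (hX : X.IsHermitian) (v : n → ℂ) :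
    v ∈ supp X ↔ suppProj X *ᵥ v = v := by
  constructor
  · rintro ⟨w, rfl⟩
    simp [mulVec_mulVec, suppProj_mul hX]
  · intro h
    refine ⟨cfc (fun x : ℝ => x⁻¹) X *ᵥ v, ?_⟩
    simp [mulVec_mulVec, mul_cfc_inv hX, h]

theorem supp_le_supp_iff {X Y : Matrix n n ℂ} (hY : Y.IsHermitian) :
    supp X ≤ supp Y ↔ suppProj Y * X = X := by
  constructor
  · intro h
    refine ext_of_mulVec_single fun i => ?_
    rw [← mulVec_mulVec]
    exact (mem_supp_iff hY _).1 (h ⟨_, rfl⟩)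
  · rintro h _ ⟨w, rfl⟩
    rw [mem_supp_iff hY]
    simp [mulVec_mulVec, h]

/-- Relabelling the rows of a diagonalizing unitary, but not its columns, diagonalizes the
relabelled matrix; this is why `cfc_conj_diagonal` allows two index types. -/
theorem cfc_submatrix_equiv {X : Matrix n n ℂ} (hX : X.IsHermitian) (e : m ≃ n) (f : ℝ → ℝ) :
    cfc f (X.submatrix e e) = (cfc f X).submatrix e e := by
  obtain ⟨U, hU, hU', hXU⟩ := exists_diagonalization hX
  set d := hX.eigenvalues
  have key : ∀ D : n → ℂ, (U * diagonal D * Uᴴ).submatrix e e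
      = U.submatrix e id * diagonal D * (U.submatrix e id)ᴴ := by
    intro D
    rw [conjTranspose_submatrix, submatrix_mul _ _ e id e Function.bijective_id,
      submatrix_mul _ _ e id id Function.bijective_id, submatrix_id_id]
  rw [hXU, key, cfc_conj_diagonal hU hU', key, cfc_conj_diagonal]
  · rw [conjTranspose_submatrix, submatrix_mul_equiv _ _ id e id, hU, submatrix_id_id]
  · rw [conjTranspose_submatrix, ← submatrix_mul _ _ e id e Function.bijective_id, hU',
      submatrix_one_equiv]

/-- The eigenvalues of a tensor product are products of eigenvalues, in the product eigenbasis. The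
two-term form covers both the logarithm and the support indicator. -/
theorem cfc_kronecker {X : Matrix n n ℂ} {Y : Matrix m m ℂ} (hX : X.IsHermitian)
    (hY : Y.IsHermitian) {f g₁ h₁ g₂ h₂ : ℝ → ℝ}
    (hf : ∀ x y, f (x * y) = g₁ x * h₁ y + g₂ x * h₂ y) :
    cfc f (X ⊗ₖ Y) = cfc g₁ X ⊗ₖ cfc h₁ Y + cfc g₂ X ⊗ₖ cfc h₂ Y := by
  obtain ⟨U, hU, hU', hXU⟩ := exists_diagonalization hX
  obtain ⟨V, hV, hV', hYV⟩ := exists_diagonalization hY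
  set d := hX.eigenvalues
  set e := hY.eigenvalues
  have key : ∀ (D : n → ℂ) (E : m → ℂ), (U * diagonal D * Uᴴ) ⊗ₖ (V * diagonal E * Vᴴ)
      = (U ⊗ₖ V) * (diagonal fun i => D i.1 * E i.2) * (U ⊗ₖ V)ᴴ := by
    intro D E
    rw [mul_kronecker_mul, mul_kronecker_mul, diagonal_kronecker_diagonal, conjTranspose_kronecker]
  rw [hXU, hYV, key]
  simp only [← Complex.ofReal_mul]
  rw [cfc_conj_diagonal hU hU', cfc_conj_diagonal hU hU',
    cfc_conj_diagonal hV hV', cfc_conj_diagonal hV hV', key, key, ← Matrix.add_mul,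
    ← Matrix.mul_add, diagonal_add, cfc_conj_diagonal (d := fun i : n × m => d i.1 * e i.2)]
  · congr 3
    ext i
    norm_cast
    exact hf _ _
  · rw [conjTranspose_kronecker, ← mul_kronecker_mul, hU, hV, one_kronecker_one]
  · rw [conjTranspose_kronecker, ← mul_kronecker_mul, hU', hV', one_kronecker_one]

/-- With `log 0 = 0`, the rule `log (x * y) = log x + log y` fails when one factor vanishes.
Multiplying each term by the indicator of the other factor repairs it, whence the support
projections. -/
theorem mlog_kronecker {X : Matrix n n ℂ} {Y : Matrix m m ℂ} (hX : X.IsHermitian)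
    (hY : Y.IsHermitian) :
    mlog (X ⊗ₖ Y) = mlog X ⊗ₖ suppProj Y + suppProj X ⊗ₖ mlog Y := by
  refine cfc_kronecker hX hY fun x y => ?_
  by_cases h1 : x = 0
  · simp [h1]
  by_cases h2 : y = 0
  · simp [h2]
  simp [h1, h2, Real.log_mul]

theorem suppProj_kronecker {X : Matrix n n ℂ} {Y : Matrix m m ℂ} (hX : X.IsHermitian)
    (hY : Y.IsHermitian) : suppProj (X ⊗ₖ Y) = suppProj X ⊗ₖ suppProj Y := by
  have h := cfc_kronecker hX hY (f := fun x : ℝ => if x = 0 then 0 else 1)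
    (g₁ := fun x : ℝ => if x = 0 then 0 else 1) (h₁ := fun x : ℝ => if x = 0 then 0 else 1)
    (g₂ := fun _ => 0) (h₂ := fun _ => 0) fun x y => by
      by_cases h1 : x = 0
      · simp [h1]
      by_cases h2 : y = 0 <;> simp [h1, h2]
  simpa [suppProj] using h

end Spectral


/-! ### Compactness of the state space and continuity of the shifted functional calculus -/

section Compactness

variable {n : Type*} [Fintype n]

theorem isClosed_posSemidef : IsClosed {X : Matrix n n ℂ | X.PosSemidef} := by
  simp only [posSemidef_iff_dotProduct_mulVec, Set.ofPred_and, Set.ofPred_forall]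
  refine IsClosed.inter ?_ (isClosed_iInter fun v => ?_)
  · exact isClosed_eq (continuous_id.matrix_conjTranspose) continuous_id
  · refine isClosed_le continuous_const ?_
    exact Continuous.dotProduct continuous_const (continuous_id.matrix_mulVec continuous_const)

theorem posSemidef_norm_apply_le {X : Matrix n n ℂ} (hX : X.PosSemidef) (i j : n) :
    ‖X i j‖ ≤ X.trace.re := by
  classical
  obtain ⟨U, hU, hU', hXU⟩ := exists_diagonalization hX.isHermitian
  have hUm : U ∈ unitaryGroup n ℂ := mem_unitaryGroup_iff.2 hU'
  have htr : X.trace.re = ∑ k, hX.isHermitian.eigenvalues k := by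
    conv_lhs => rw [hXU, trace_conj_diagonal hU]
  rw [htr]
  conv_lhs => rw [hXU, Matrix.mul_apply]
  refine (norm_sum_le _ _).trans (Finset.sum_le_sum fun k _ => ?_)
  have h0 := hX.eigenvalues_nonneg k
  rw [mul_diagonal, norm_mul, norm_mul, conjTranspose_apply, norm_star, Complex.norm_real,
    Real.norm_of_nonneg h0]
  have h1 := entry_norm_bound_of_unitary hUm i k
  have h2 := entry_norm_bound_of_unitary hUm j k
  calc _ ≤ 1 * hX.isHermitian.eigenvalues k * 1 := by gcongr
    _ = _ := by ring

theorem isCompact_setOf_isState : IsCompact {X : Matrix n n ℂ | IsState X} := by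
  have hc : IsCompact (Set.pi Set.univ fun _ : n => Set.pi Set.univ fun _ : n =>
      Metric.closedBall (0 : ℂ) 1) :=
    isCompact_univ_pi fun _ => isCompact_univ_pi fun _ => isCompact_closedBall _ _
  refine hc.of_isClosed_subset (t := {X : Matrix n n ℂ | IsState X}) ?_ ?_
  · exact isClosed_posSemidef.inter (isClosed_eq (continuous_id.matrix_trace) continuous_const)
  · rintro X ⟨hX, htr⟩ i - j -
    rw [mem_closedBall_zero_iff]
    simpa [htr] using posSemidef_norm_apply_le hX i j

variable [DecidableEq n]

theorem spectrum_add_smul_one_subset {X : Matrix n n ℂ} (hX : IsState X) (ε : ℝ) :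
    spectrum ℝ (X + (ε : ℂ) • 1) ⊆ Set.Icc ε (1 + ε) := by
  intro x hx
  have hs : (ε : ℂ) • (1 : Matrix n n ℂ) = algebraMap ℝ (Matrix n n ℂ) ε := by
    rw [Algebra.algebraMap_eq_smul_one]
    ext i j
    simp
  rw [hs, add_comm, ← spectrum.singleton_add_eq] at hx
  obtain ⟨a, ha, y, hy, rfl⟩ := hx
  obtain rfl : a = ε := ha
  rw [hX.1.isHermitian.spectrum_real_eq_range_eigenvalues] at hy
  obtain ⟨i, rfl⟩ := hy
  have h0 := hX.1.eigenvalues_nonneg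
  have h1 : ∑ k, hX.1.isHermitian.eigenvalues k = 1 := by
    have := hX.1.isHermitian.trace_eq_sum_eigenvalues
    simpa using congrArg Complex.re (this.symm.trans hX.2)
  have h2 := Finset.single_le_sum (fun k _ => h0 k) (Finset.mem_univ i)
  have h3 := h0 i
  constructor <;> simp only <;> linarith

theorem isHermitian_smul_one (ε : ℝ) : ((ε : ℂ) • (1 : Matrix n n ℂ)).IsHermitian := by
  rw [IsHermitian, conjTranspose_smul]
  simp

open scoped Matrix.Norms.L2Operator in
-- States have spectrum in `[0, 1]`, so one compact interval contains all shifted spectra. For `ε >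
-- 0` it avoids the singularity of `log`.
theorem continuousOn_cfc_add_smul_one {f : ℝ → ℝ} {ε : ℝ}
    (hf : ContinuousOn f (Set.Icc ε (1 + ε))) :
    ContinuousOn (fun X : Matrix n n ℂ => cfc f (X + (ε : ℂ) • 1)) {X | IsState X} := by
  refine ContinuousOn.cfc' isCompact_Icc f ?_ (fun X hX => spectrum_add_smul_one_subset hX ε)
    (fun X hX => ?_) hf
  · exact (continuous_id.add continuous_const).continuousOn
  · exact hX.1.isHermitian.add (isHermitian_smul_one ε)

end Compactness

/-! ### Factorization of positive operators -/

section Positivity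

variable {n : Type*} [Fintype n] [DecidableEq n]

theorem exists_eq_conjTranspose_mul_self {X : Matrix n n ℂ} (hX : X.PosSemidef) :
    ∃ B : Matrix n n ℂ, X = Bᴴ * B := by
  obtain ⟨U, -, -, hXU⟩ := exists_diagonalization hX.isHermitian
  refine ⟨(diagonal fun i => (Real.sqrt (hX.isHermitian.eigenvalues i) : ℂ)) * Uᴴ, ?_⟩
  conv_lhs => rw [hXU]
  rw [conjTranspose_mul, conjTranspose_conjTranspose, diagonal_conjTranspose, Matrix.mul_assoc U,
    Matrix.mul_assoc U, ← Matrix.mul_assoc (diagonal _) (diagonal _), diagonal_mul_diagonal]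
  congr 3
  ext i
  have h := Real.mul_self_sqrt (hX.eigenvalues_nonneg i)
  simp only [Pi.star_apply, Complex.star_def, Complex.conj_ofReal, ← Complex.ofReal_mul, h]

/-- Writing `X = Bᴴ * B`, the trace hypothesis says that `B * (1 - Q)` has Hilbert–Schmidt norm
zero. -/
theorem mul_eq_self_of_trace {X Q : Matrix n n ℂ} (hX : X.PosSemidef) (hQ : Q.IsHermitian)
    (hQ2 : Q * Q = Q) (h : (Q * X).trace = X.trace) : Q * X = X := by
  obtain ⟨B, rfl⟩ := exists_eq_conjTranspose_mul_self hX
  have hC : (1 - Q)ᴴ = 1 - Q := by rw [conjTranspose_sub, conjTranspose_one, hQ.eq]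
  have hC2 : (1 - Q) * (1 - Q) = 1 - Q := by
    rw [Matrix.sub_mul, Matrix.mul_sub, Matrix.mul_sub, hQ2]
    simp
  have h0 : ((B * (1 - Q))ᴴ * (B * (1 - Q))).trace = 0 := by
    rw [conjTranspose_mul, hC, Matrix.mul_assoc, Matrix.trace_mul_comm, Matrix.mul_assoc,
      Matrix.mul_assoc, hC2, ← Matrix.mul_assoc, Matrix.mul_sub, trace_sub, Matrix.mul_one,
      Matrix.trace_mul_comm _ Q, h, sub_self]
  have h1 := congrArg conjTranspose (trace_conjTranspose_mul_self_eq_zero_iff.1 h0)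
  rw [conjTranspose_mul, hC, conjTranspose_zero, Matrix.sub_mul, Matrix.one_mul, sub_eq_zero] at h1
  rw [← Matrix.mul_assoc, ← h1]

end Positivity

/-! ### Partial traces and supports of marginals -/

section PartialTrace

variable {X Y : Type*} [Fintype X] [Fintype Y] [DecidableEq X] [DecidableEq Y]

theorem trace_ptraceRight (M : Matrix (X × Y) (X × Y) ℂ) : (ptraceRight M).trace = M.trace := by
  simp [ptraceRight, trace, Fintype.sum_prod_type]

theorem trace_ptraceRight_mul (M : Matrix (X × Y) (X × Y) ℂ) (K : Matrix X X ℂ) :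
    (ptraceRight M * K).trace = (M * (K ⊗ₖ (1 : Matrix Y Y ℂ))).trace := by
  simp only [trace, diag_apply, Matrix.mul_apply, ptraceRight, of_apply, Fintype.sum_prod_type,
    kroneckerMap_apply, one_apply, Finset.sum_mul]
  refine Finset.sum_congr rfl fun x _ => ?_
  rw [Finset.sum_comm]
  refine Finset.sum_congr rfl fun y _ => Finset.sum_congr rfl fun x' _ => ?_
  simp

theorem posSemidef_ptraceRight {M : Matrix (X × Y) (X × Y) ℂ} (hM : M.PosSemidef) :
    (ptraceRight M).PosSemidef := by
  have : ptraceRight M = ∑ y, M.submatrix (fun x => (x, y)) (fun x => (x, y)) := by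
    ext x x'
    simp [ptraceRight, Matrix.sum_apply]
  rw [this]
  exact posSemidef_sum _ fun y _ => hM.submatrix _

theorem mul_ptraceRight (K : Matrix X X ℂ) (M : Matrix (X × Y) (X × Y) ℂ) :
    K * ptraceRight M = ptraceRight ((K ⊗ₖ (1 : Matrix Y Y ℂ)) * M) := by
  ext x x'
  simp only [Matrix.mul_apply, ptraceRight, of_apply, Fintype.sum_prod_type,
    kroneckerMap_apply, one_apply, Finset.mul_sum]
  rw [Finset.sum_comm]
  refine Finset.sum_congr rfl fun y _ => Finset.sum_congr rfl fun x' _ => ?_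
  simp

theorem IsState.ptraceRight {M : Matrix (X × Y) (X × Y) ℂ} (hM : IsState M) :
    IsState (ptraceRight M) :=
  ⟨posSemidef_ptraceRight hM.1, by rw [trace_ptraceRight, hM.2]⟩

theorem continuous_ptraceRight :
    Continuous (ptraceRight : Matrix (X × Y) (X × Y) ℂ → Matrix X X ℂ) :=
  continuous_matrix fun x x' => continuous_finsetSum _ fun y _ =>
    continuous_id.matrix_elem (x, y) (x', y)

theorem isHermitian_kronecker_one {Q : Matrix X X ℂ} (hQ : Q.IsHermitian) :
    (Q ⊗ₖ (1 : Matrix Y Y ℂ)).IsHermitian := by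
  rw [IsHermitian, conjTranspose_kronecker, hQ.eq, conjTranspose_one]

theorem kronecker_one_mul_kronecker_one (P Q : Matrix X X ℂ) :
    (P ⊗ₖ (1 : Matrix Y Y ℂ)) * (Q ⊗ₖ (1 : Matrix Y Y ℂ)) = (P * Q) ⊗ₖ 1 := by
  rw [← mul_kronecker_mul, Matrix.mul_one]

/-- A positive semidefinite operator is supported on `Q ⊗ Y` if and only if its marginal is
supported on `Q`. -/
theorem mul_ptraceRight_eq_self_iff {M : Matrix (X × Y) (X × Y) ℂ} (hM : M.PosSemidef)
    {Q : Matrix X X ℂ} (hQ : Q.IsHermitian) (hQ2 : Q * Q = Q) :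
    Q * ptraceRight M = ptraceRight M ↔ (Q ⊗ₖ (1 : Matrix Y Y ℂ)) * M = M := by
  constructor
  · intro h
    refine mul_eq_self_of_trace hM (isHermitian_kronecker_one hQ) ?_ ?_
    · rw [kronecker_one_mul_kronecker_one, hQ2]
    · rw [← trace_ptraceRight, ← mul_ptraceRight, h, trace_ptraceRight]
  · intro h
    rw [mul_ptraceRight, h]

variable {A D F : Type*} [Fintype A] [Fintype D] [Fintype F] [DecidableEq A] [DecidableEq D]
  [DecidableEq F]

/-- The partial trace over the middle tensor factor. -/
def ptraceMid (M : Matrix ((A × D) × F) ((A × D) × F) ℂ) : Matrix (A × F) (A × F) ℂ :=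
  Matrix.of fun p q => ∑ d, M ((p.1, d), p.2) ((q.1, d), q.2)

theorem trace_ptraceMid (M : Matrix ((A × D) × F) ((A × D) × F) ℂ) :
    (ptraceMid M).trace = M.trace := by
  simp only [ptraceMid, trace, Fintype.sum_prod_type, diag_apply, of_apply]
  exact Finset.sum_congr rfl fun a _ => Finset.sum_comm

theorem trace_ptraceMid_mul (M : Matrix ((A × D) × F) ((A × D) × F) ℂ)
    (S : Matrix (A × F) (A × F) ℂ) :
    (ptraceMid M * S).trace = (M * oneTensor S).trace := by
  simp only [trace, diag_apply, Matrix.mul_apply, ptraceMid, of_apply, Fintype.sum_prod_type,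
    oneTensor, Finset.sum_mul]
  have h : ∀ a d f a', ∑ d', ∑ f', M ((a, d), f) ((a', d'), f') *
      (if d' = d then S (a', f') (a, f) else 0)
        = ∑ f', M ((a, d), f) ((a', d), f') * S (a', f') (a, f) := by
    intro a d f a'
    rw [Finset.sum_eq_single d]
    · simp
    · intro d' _ hd
      simp [hd]
    · simp
  simp only [h]
  refine Finset.sum_congr rfl fun a _ => ?_
  rw [Finset.sum_comm (s := Finset.univ (α := D))]
  refine Finset.sum_congr rfl fun f _ => ?_
  rw [Finset.sum_comm (s := Finset.univ (α := D))]
  exact Finset.sum_congr rfl fun a' _ => Finset.sum_comm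

theorem posSemidef_ptraceMid {M : Matrix ((A × D) × F) ((A × D) × F) ℂ} (hM : M.PosSemidef) :
    (ptraceMid M).PosSemidef := by
  have : ptraceMid M
      = ∑ d, M.submatrix (fun p : A × F => ((p.1, d), p.2)) (fun p => ((p.1, d), p.2)) := by
    ext p q
    simp [ptraceMid, Matrix.sum_apply]
  rw [this]
  exact posSemidef_sum _ fun y _ => hM.submatrix _

theorem IsState.ptraceMid {M : Matrix ((A × D) × F) ((A × D) × F) ℂ} (hM : IsState M) :
    IsState (ptraceMid M) :=
  ⟨posSemidef_ptraceMid hM.1, by rw [trace_ptraceMid, hM.2]⟩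

theorem continuous_ptraceMid :
    Continuous (QRec.ptraceMid :
      Matrix ((A × D) × F) ((A × D) × F) ℂ → Matrix (A × F) (A × F) ℂ) :=
  continuous_matrix fun p q => continuous_finsetSum _ fun d _ =>
    continuous_id.matrix_elem ((p.1, d), p.2) ((q.1, d), q.2)

end PartialTrace

/-! ### The dual constraint tested against positive operators -/

section DualConstraint

variable {n : Type*} [Fintype n] [DecidableEq n]

theorem trace_vecMulVec_mul (v : n → ℂ) (H : Matrix n n ℂ) :
    (vecMulVec v (star v) * H).trace = star v ⬝ᵥ H *ᵥ v := by
  rw [vecMulVec_mul, trace_vecMulVec, dotProduct_comm, dotProduct_mulVec]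

variable {A D F : Type*} [Fintype A] [Fintype D] [Fintype F] [DecidableEq A] [DecidableEq D]
  [DecidableEq F]

theorem kronecker_one_mulVec (Q : Matrix A A ℂ) (v : A × F → ℂ) (a : A) (f : F) :
    ((Q ⊗ₖ (1 : Matrix F F ℂ)) *ᵥ v) (a, f) = (Q *ᵥ fun x => v (x, f)) a := by
  simp [mulVec, dotProduct, Fintype.sum_prod_type, one_apply]

theorem forall_mem_supp_iff {ρ : Matrix A A ℂ} (hρ : ρ.IsHermitian) (v : A × F → ℂ) :
    (∀ f, (fun x => v (x, f)) ∈ supp ρ) ↔ (suppProj ρ ⊗ₖ (1 : Matrix F F ℂ)) *ᵥ v = v := by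
  simp only [mem_supp_iff hρ, funext_iff, Prod.forall, kronecker_one_mulVec]
  exact forall_comm

/-- The constraint of the dual problem in terms of positive semidefinite operators. -/
theorem dualConstraint_iff {ρ R : Matrix (A × D) (A × D) ℂ} {S : Matrix (A × F) (A × F) ℂ}
    (hρ : ρ.IsHermitian) : DualConstraint ρ R S ↔
      ∀ γ : Matrix ((A × D) × F) ((A × D) × F) ℂ, γ.PosSemidef →
        (suppProj ρ ⊗ₖ (1 : Matrix F F ℂ)) * γ = γ →
        (γ * ((mlog ρ - mlog R) ⊗ₖ (1 : Matrix F F ℂ))).trace.re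
          ≤ (γ * oneTensor S).trace.re := by
  have hQ := isHermitian_kronecker_one (Y := F) (isHermitian_suppProj ρ)
  constructor
  · intro h γ hγ hQγ
    obtain ⟨B, rfl⟩ := exists_eq_conjTranspose_mul_self hγ
    set Q := suppProj ρ ⊗ₖ (1 : Matrix F F ℂ)
    have hB : Q * Bᴴ = Bᴴ := by
      -- The support condition on `Bᴴ * B` passes to the columns of `Bᴴ`. These are the vectors at
      -- which the quadratic forms are evaluated, because `Bᴴ * B` is the sum of their rank-one
      -- operators.
      have h1 : B * (1 - Q) = 0 := by
        rw [← conjTranspose_mul_self_mul_eq_zero, Matrix.mul_sub, Matrix.mul_one, sub_eq_zero]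
        simpa [conjTranspose_mul, hQ.eq] using (congrArg conjTranspose hQγ).symm
      have h2 := congrArg conjTranspose h1
      rw [conjTranspose_mul, conjTranspose_sub, hQ.eq, conjTranspose_one, conjTranspose_zero,
        Matrix.sub_mul, Matrix.one_mul, sub_eq_zero] at h2
      exact h2.symm
    have key : ∀ H : Matrix ((A × D) × F) ((A × D) × F) ℂ, (Bᴴ * B * H).trace.re
        = ∑ k, (star (fun x => Bᴴ x k) ⬝ᵥ (H *ᵥ fun x => Bᴴ x k)).re := by
      intro H
      rw [Matrix.mul_assoc, Matrix.trace_mul_comm, trace, Complex.re_sum]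
      refine Finset.sum_congr rfl fun k _ => ?_
      rw [diag_apply, Matrix.mul_assoc, Matrix.mul_apply, dotProduct]
      congr 1
      refine Finset.sum_congr rfl fun x _ => ?_
      simp [mulVec, dotProduct, Matrix.mul_apply]
    rw [key, key]
    refine Finset.sum_le_sum fun k _ => h (fun x => Bᴴ x k)
      ((forall_mem_supp_iff hρ (fun x => Bᴴ x k)).2 ?_)
    ext x
    exact congrFun (congrFun hB x) k
  · intro h v hv
    rw [forall_mem_supp_iff hρ] at hv
    have := h (vecMulVec v (star v)) (posSemidef_vecMulVec_self_star v)
      (by rw [mul_vecMulVec, hv])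
    rwa [trace_vecMulVec_mul, trace_vecMulVec_mul] at this

end DualConstraint

/-! ### Strong duality for the linear problem -/

section SemidefiniteProgram

variable {n : Type*} [Fintype n] [DecidableEq n]

/-- Real-linear functionals on Hermitian matrices are represented by Hermitian matrices. -/
theorem exists_isHermitian_trace_mul (g : Matrix n n ℂ →ₗ[ℝ] ℝ) :
    ∃ S : Matrix n n ℂ, S.IsHermitian ∧
      ∀ X : Matrix n n ℂ, X.IsHermitian → g X = (S * X).trace.re := by
  -- The entries are chosen so that `(M j i * z).re` is the value of `g` at the matrix unit `(i, j)`
  -- scaled by `z`. Passing to the Hermitian part of `M` does not change the real trace against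
  -- Hermitian matrices.
  set M : Matrix n n ℂ := Matrix.of fun j i =>
    ⟨g (Matrix.single i j 1), -g (Matrix.single i j Complex.I)⟩
  have hM : ∀ X : Matrix n n ℂ, (M * X).trace.re = g X := by
    intro X
    have hz : ∀ i j (z : ℂ), (M j i * z).re = g (Matrix.single i j z) := by
      intro i j z
      have : Matrix.single i j z = z.re • Matrix.single i j (1 : ℂ)
          + z.im • Matrix.single i j Complex.I := by
        rw [smul_single, smul_single, ← single_add]
        congr 1
        simp [Complex.re_add_im]
      rw [this, map_add, map_smul, map_smul, Complex.mul_re]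
      simp [M]
      ring
    conv_rhs => rw [matrix_eq_sum_single X, map_sum]
    simp only [map_sum, ← hz, trace, diag_apply, Matrix.mul_apply, Complex.re_sum]
    exact Finset.sum_comm
  refine ⟨(2⁻¹ : ℝ) • (M + Mᴴ), ?_, fun X hX => ?_⟩
  · rw [IsHermitian, conjTranspose_smul, conjTranspose_add, conjTranspose_conjTranspose, add_comm]
    simp
  · have h2 : (Mᴴ * X).trace.re = (M * X).trace.re := by
      rw [← hX.eq, ← conjTranspose_mul, trace_conjTranspose, Matrix.trace_mul_comm, hX.eq]
      simp
    rw [Matrix.smul_mul, trace_smul, Matrix.add_mul, trace_add, Complex.smul_re, Complex.add_re,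
      h2, hM, smul_eq_mul]
    ring

theorem convex_setOf_isState : Convex ℝ {X : Matrix n n ℂ | IsState X} := by
  rintro X ⟨hX, hX1⟩ Y ⟨hY, hY1⟩ a b ha hb hab
  refine ⟨(hX.smul ha).add (hY.smul hb), ?_⟩
  rw [trace_add, trace_smul, trace_smul, hX1, hY1, ← add_smul, hab, one_smul]

/-- The states supported on `Q`. -/
def statesOn (Q : Matrix n n ℂ) : Set (Matrix n n ℂ) := {X | IsState X ∧ Q * X = X}

theorem isCompact_statesOn (Q : Matrix n n ℂ) : IsCompact (statesOn Q) :=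
  isCompact_setOf_isState.inter_right
    (isClosed_eq (continuous_const.matrix_mul continuous_id) continuous_id)

theorem convex_statesOn (Q : Matrix n n ℂ) : Convex ℝ (statesOn Q) := by
  rintro X ⟨hX, hX1⟩ Y ⟨hY, hY1⟩ a b ha hb hab
  refine ⟨convex_setOf_isState hX hY ha hb hab, ?_⟩
  rw [Matrix.mul_add, Matrix.mul_smul, Matrix.mul_smul, hX1, hY1]

/-- Both sides are homogeneous in `γ`, and a positive operator of trace zero vanishes. -/
theorem trace_mul_re_le_of_statesOn {Q H K : Matrix n n ℂ}
    (h : ∀ γ ∈ statesOn Q, (γ * H).trace.re ≤ (γ * K).trace.re) (γ : Matrix n n ℂ)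
    (hγ : γ.PosSemidef) (hQ : Q * γ = γ) : (γ * H).trace.re ≤ (γ * K).trace.re := by
  have h0 : 0 ≤ γ.trace.re := (Complex.le_def.1 hγ.trace_nonneg).1
  have him : γ.trace.im = 0 := (Complex.le_def.1 hγ.trace_nonneg).2.symm
  rcases h0.eq_or_lt with h0 | h0
  · have : γ = 0 := hγ.trace_eq_zero_iff.1 (Complex.ext h0.symm him)
    simp [this]
  · have := h (γ.trace.re⁻¹ • γ) ⟨⟨hγ.smul (inv_nonneg.2 h0.le), ?_⟩, ?_⟩
    · rw [Matrix.smul_mul, Matrix.smul_mul, trace_smul, trace_smul, Complex.smul_re,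
        Complex.smul_re] at this
      exact le_of_mul_le_mul_left this (inv_pos.2 h0)
    · rw [trace_smul]
      apply Complex.ext <;> simp [him, h0.ne']
    · rw [Matrix.mul_smul, hQ]

theorem continuous_trace_mul_re (H : Matrix n n ℂ) :
    Continuous fun γ : Matrix n n ℂ => (γ * H).trace.re :=
  Complex.continuous_re.comp (continuous_id.matrix_mul continuous_const).matrix_trace

variable {A D F : Type*} [Fintype A] [Fintype D] [Fintype F] [DecidableEq A] [DecidableEq D]
  [DecidableEq F]

/-- The linear map whose image of the states on `Q` is separated from a point in the duality
theorem. -/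
def primalMap (H : Matrix ((A × D) × F) ((A × D) × F) ℂ) :
    Matrix ((A × D) × F) ((A × D) × F) ℂ →ₗ[ℝ] Matrix (A × F) (A × F) ℂ × ℝ where
  toFun γ := (ptraceMid γ, -(γ * H).trace.re)
  map_add' X Y := by
    refine Prod.ext (Matrix.ext fun p q => ?_) ?_
    · simp [ptraceMid, Finset.sum_add_distrib]
    · simp [Matrix.add_mul]
      ring
  map_smul' r X := by
    refine Prod.ext (Matrix.ext fun p q => ?_) ?_
    · simp [ptraceMid, Finset.mul_sum]
    · simp

open scoped Pointwise in
/-- Strong duality for the semidefinite program `inf {-tr[γ H] : tr_D γ = σ, γ ≥ 0 on Q}`. -/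
theorem exists_dual_feasible {Q H : Matrix ((A × D) × F) ((A × D) × F) ℂ}
    {σ : Matrix (A × F) (A × F) ℂ} (hσ : IsState σ) {w : ℝ}
    (h : ∀ γ ∈ statesOn Q, ptraceMid γ = σ → w < -(γ * H).trace.re) :
    ∃ S : Matrix (A × F) (A × F) ℂ, S.IsHermitian ∧
      (∀ γ : Matrix ((A × D) × F) ((A × D) × F) ℂ, γ.PosSemidef → Q * γ = γ →
        (γ * H).trace.re ≤ (γ * oneTensor S).trace.re) ∧ w < -(S * σ).trace.re := by
  suffices hS : ∃ S : Matrix (A × F) (A × F) ℂ, S.IsHermitian ∧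
      (∀ γ ∈ statesOn Q, (γ * H).trace.re ≤ (S * ptraceMid γ).trace.re) ∧
        w < -(S * σ).trace.re by
    obtain ⟨S, hS1, hS2, hS3⟩ := hS
    refine ⟨S, hS1, trace_mul_re_le_of_statesOn fun γ hγ => ?_, hS3⟩
    rw [← trace_ptraceMid_mul, Matrix.trace_mul_comm (ptraceMid γ)]
    exact hS2 γ hγ
  have hone : ∀ (r : ℝ) (X : Matrix (A × F) (A × F) ℂ), IsState X →
      (((r : ℂ) • (1 : Matrix (A × F) (A × F) ℂ)) * X).trace.re = r := by
    intro r X hX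
    rw [Matrix.smul_mul, Matrix.one_mul, trace_smul, hX.2]
    simp
  rcases (statesOn Q).eq_empty_or_nonempty with hemp | ⟨γ₀, hγ₀⟩
  -- Without states on `Q` the constraint is vacuous, and this multiple of the identity has
  -- objective value `w + 1`.
  · refine ⟨((-w - 1 : ℝ) : ℂ) • 1, isHermitian_smul_one _, by simp [hemp], ?_⟩
    rw [hone _ _ hσ]
    linarith
  -- The achievable pairs of marginal and objective value, closed upward in the value. Compact plus
  -- closed is closed, so `(σ, w)` can be strictly separated from it.
  set t : Set (Matrix (A × F) (A × F) ℂ × ℝ) :=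
    primalMap H '' statesOn Q + ({0} : Set (Matrix (A × F) (A × F) ℂ)) ×ˢ Set.Ici (0 : ℝ)
  have hcont : Continuous (primalMap (A := A) (D := D) (F := F) H) :=
    continuous_ptraceMid.prodMk (continuous_trace_mul_re H).neg
  have htc : IsClosed t :=
    (isClosed_singleton.prod isClosed_Ici).add_left_of_isCompact ((isCompact_statesOn Q).image hcont)
  have htv : Convex ℝ t :=
    ((convex_statesOn Q).linear_image _).add ((convex_singleton _).prod (convex_Ici _))
  have hmem : ∀ γ ∈ statesOn Q, ∀ s : ℝ, 0 ≤ s → (ptraceMid γ, -(γ * H).trace.re + s) ∈ t := by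
    intro γ hγ s hs
    exact ⟨_, ⟨γ, hγ, rfl⟩, (0, s), ⟨rfl, hs⟩, by simp [primalMap]⟩
  have hnot : (σ, w) ∉ t := by
    rintro ⟨_, ⟨γ, hγ, rfl⟩, ⟨x, s⟩, ⟨hx, hs⟩, heq⟩
    obtain rfl : x = 0 := hx
    simp only [primalMap, LinearMap.coe_mk, AddHom.coe_mk, Prod.mk_add_mk, add_zero,
      Prod.mk.injEq] at heq
    have := h γ hγ heq.1
    have hs' : (0 : ℝ) ≤ s := hs
    linarith [heq.2]
  open scoped Matrix.Norms.L2Operator in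
  obtain ⟨f, u, hf1, hf2⟩ := geometric_hahn_banach_point_closed htv htc hnot
  obtain ⟨S₀, hS₀, hg⟩ := exists_isHermitian_trace_mul
    ((f : Matrix (A × F) (A × F) ℂ × ℝ →ₗ[ℝ] ℝ) ∘ₗ LinearMap.inl ℝ _ _)
  set l : ℝ := f (0, 1)
  have hf : ∀ (X : Matrix (A × F) (A × F) ℂ) (s : ℝ), X.IsHermitian →
      f (X, s) = (S₀ * X).trace.re + s * l := by
    intro X s hX
    have h1 : (X, s) = LinearMap.inl ℝ _ ℝ X + s • ((0, 1) : Matrix (A × F) (A × F) ℂ × ℝ) := by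
      simp
    rw [h1, map_add, map_smul, ← hg X hX]
    rfl
  have hγH : ∀ γ ∈ statesOn Q, (ptraceMid γ).IsHermitian := fun γ hγ =>
    (posSemidef_ptraceMid hγ.1.1).isHermitian
  have hsep : ∀ γ ∈ statesOn Q, ∀ s : ℝ, 0 ≤ s →
      u < (S₀ * ptraceMid γ).trace.re + (-(γ * H).trace.re + s) * l := by
    intro γ hγ s hs
    rw [← hf _ _ (hγH γ hγ)]
    exact hf2 _ (hmem γ hγ s hs)
  rw [hf _ _ hσ.1.isHermitian] at hf1
  -- A negative coefficient on the value coordinate would make the functional unbounded below on the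
  -- upward closed set `t`.
  have hl : 0 ≤ l := by
    by_contra! hl
    set b := (S₀ * ptraceMid γ₀).trace.re + (-(γ₀ * H).trace.re) * l with hb
    have h1 := hsep γ₀ hγ₀ ((|b - u|) / (-l)) (by positivity [neg_pos.2 hl])
    have h2 : |b - u| / (-l) * l = -|b - u| := by
      rw [div_neg, neg_mul, div_mul_cancel₀ _ hl.ne]
    rw [add_mul, h2, ← add_assoc] at h1
    have := le_abs_self (b - u)
    linarith
  have hSt : ∀ r c : ℝ, ((r : ℂ) • S₀ + (c : ℂ) • 1).IsHermitian := by
    intro r c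
    refine IsHermitian.add ?_ (isHermitian_smul_one c)
    rw [IsHermitian, conjTranspose_smul, hS₀.eq]
    simp
  have htr : ∀ (r c : ℝ) (X : Matrix (A × F) (A × F) ℂ), IsState X →
      (((r : ℂ) • S₀ + (c : ℂ) • 1) * X).trace.re = r * (S₀ * X).trace.re + c := by
    intro r c X hX
    rw [Matrix.add_mul, trace_add, Complex.add_re, hone c X hX, Matrix.smul_mul, trace_smul]
    simp
  rcases hl.eq_or_lt with hl | hl
  -- Vertical hyperplane: the functional separates `σ` itself from all achievable marginals, by a
  -- gap `δ`. Scaling it by a large `N` pushes the objective above `w`, while the bound `c` on `tr[γ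
  -- H]` keeps the pair feasible.
  · obtain ⟨c, hc⟩ := (isCompact_statesOn Q).bddAbove_image
      (continuous_trace_mul_re H).continuousOn
    rw [← hl] at hf1 hsep
    simp only [mul_zero, add_zero] at hf1 hsep
    set δ := u - (S₀ * σ).trace.re with hδ
    have hδ0 : 0 < δ := by linarith
    set N : ℝ := (|w + c| + 1) / δ
    have hN : N * δ = |w + c| + 1 := by
      simp only [N]
      field_simp
    have hN0 : 0 ≤ N := by positivity
    refine ⟨(N : ℂ) • S₀ + ((c - N * u : ℝ) : ℂ) • 1, hSt _ _, fun γ hγ => ?_, ?_⟩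
    · rw [htr _ _ _ hγ.1.ptraceMid]
      have h1 : (γ * H).trace.re ≤ c := hc ⟨γ, hγ, rfl⟩
      have h2 := mul_le_mul_of_nonneg_left (hsep γ hγ 0 le_rfl).le hN0
      linarith
    · rw [htr _ _ _ hσ]
      have h1 := le_abs_self (w + c)
      rw [hδ] at hN
      linarith
  -- Here the hyperplane is the graph of an affine function of the marginal; the constant `u` is
  -- absorbed into a multiple of the identity, since states have trace one.
  · refine ⟨((l⁻¹ : ℝ) : ℂ) • S₀ + ((-(l⁻¹ * u) : ℝ) : ℂ) • 1, hSt _ _, fun γ hγ => ?_, ?_⟩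
    · rw [htr _ _ _ hγ.1.ptraceMid]
      have h1 := hsep γ hγ 0 le_rfl
      have h2 := mul_lt_mul_of_pos_left h1 (inv_pos.2 hl)
      have h3 : l⁻¹ * ((S₀ * ptraceMid γ).trace.re + (-(γ * H).trace.re + 0) * l)
          = l⁻¹ * (S₀ * ptraceMid γ).trace.re - (γ * H).trace.re := by
        field_simp
        ring
      linarith
    · rw [htr _ _ _ hσ]
      have h2 := mul_lt_mul_of_pos_left hf1 (inv_pos.2 hl)
      have h3 : l⁻¹ * ((S₀ * σ).trace.re + w * l) = l⁻¹ * (S₀ * σ).trace.re + w := by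
        field_simp
      linarith

end SemidefiniteProgram

/-! ### Relative entropy and first-order optimality -/

section RelativeEntropy

variable {n : Type*} [Fintype n] [DecidableEq n]

theorem relEntropy_of_suppProj {γ ρ : Matrix n n ℂ} (hρ : ρ.IsHermitian)
    (h : suppProj ρ * γ = γ) :
    relEntropy γ ρ = (((γ * (mlog γ - mlog ρ)).trace.re : ℝ) : EReal) :=
  if_pos ((supp_le_supp_iff hρ).2 h)

theorem relEntropy_of_not_suppProj {γ ρ : Matrix n n ℂ} (hρ : ρ.IsHermitian)
    (h : suppProj ρ * γ ≠ γ) : relEntropy γ ρ = ⊤ :=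
  if_neg fun h' => h ((supp_le_supp_iff hρ).1 h')

theorem posDef_add_smul_one {X : Matrix n n ℂ} (hX : X.PosSemidef) {ε : ℝ} (hε : 0 < ε) :
    (X + (ε : ℂ) • 1).PosDef :=
  PosDef.posSemidef_add hX (PosDef.one.smul (by exact_mod_cast hε))

theorem continuousOn_mlog_add_smul_one {ε : ℝ} (hε : 0 < ε) :
    ContinuousOn (fun X : Matrix n n ℂ => mlog (X + (ε : ℂ) • 1)) {X | IsState X} :=
  continuousOn_cfc_add_smul_one fun x hx =>
    (Real.continuousAt_log (by linarith [hx.1])).continuousWithinAt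

/-- The relative entropy with the first argument of its entropy term shifted by `ε`. -/
def shiftedEntropy (ρ : Matrix n n ℂ) (ε : ℝ) (X : Matrix n n ℂ) : ℝ :=
  ((X + (ε : ℂ) • 1) * mlog (X + (ε : ℂ) • 1)).trace.re - (X * mlog ρ).trace.re

theorem continuousOn_shiftedEntropy (ρ : Matrix n n ℂ) (ε : ℝ) :
    ContinuousOn (shiftedEntropy ρ ε) {X | IsState X} := by
  refine ContinuousOn.sub ?_ (continuous_trace_mul_re _).continuousOn
  have h : ContinuousOn (fun X : Matrix n n ℂ =>
      (cfc (fun x => x * Real.log x) (X + (ε : ℂ) • 1)).trace.re) {X | IsState X} :=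
    Complex.continuous_re.comp_continuousOn ((continuous_id.matrix_trace).comp_continuousOn
      (continuousOn_cfc_add_smul_one Real.continuous_mul_log.continuousOn))
  refine h.congr fun X hX => ?_
  simp only
  rw [mul_mlog (hX.1.isHermitian.add (isHermitian_smul_one ε))]

theorem shiftedEntropy_zero (ρ X : Matrix n n ℂ) :
    shiftedEntropy ρ 0 X = (X * (mlog X - mlog ρ)).trace.re := by
  simp [shiftedEntropy, Matrix.mul_sub]

/-- The first-order optimality condition at a minimizer of the shifted relative entropy. -/
theorem trace_mul_le_of_forall_shiftedEntropy_le {ρ X Y : Matrix n n ℂ} {ε : ℝ} (hε : 0 < ε)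
    (hX : IsState X) (hY : IsState Y)
    (h : ∀ t : ℝ, 0 < t → t ≤ 1 →
      shiftedEntropy ρ ε X ≤ shiftedEntropy ρ ε (X + (t : ℂ) • (Y - X))) :
    (X * (mlog (X + (ε : ℂ) • 1) - mlog ρ)).trace.re
      ≤ (Y * (mlog (X + (ε : ℂ) • 1) - mlog ρ)).trace.re := by
  have hst : ∀ t : ℝ, 0 ≤ t → t ≤ 1 → IsState (X + (t : ℂ) • (Y - X)) := by
    intro t h0 h1
    have he : X + (t : ℂ) • (Y - X) = (1 - t) • X + t • Y := by
      ext i j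
      simp
      ring
    rw [he]
    exact convex_setOf_isState hX hY (sub_nonneg.2 h1) h0 (by ring)
  have key : ∀ t : ℝ, 0 < t → t ≤ 1 →
      0 ≤ ((Y - X) * (mlog (X + (t : ℂ) • (Y - X) + (ε : ℂ) • 1) - mlog ρ)).trace.re := by
    intro t h0 h1
    set Z := X + (t : ℂ) • (Y - X) with hZ
    -- Klein's inequality bounds the increment of the objective from `X` to `Z` by `t` times the
    -- linear term with the logarithm taken at `Z`. Dividing by `t` and letting `t → 0` replaces
    -- differentiating the entropy.
    have hk := klein (posDef_add_smul_one hX.1 hε).posSemidef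
      (posDef_add_smul_one (hst t h0.le h1).1 hε)
    have h2 := h t h0 h1
    rw [← hZ] at hk h2
    have h3 : ((X + (ε : ℂ) • (1 : Matrix n n ℂ)).trace) = (Z + (ε : ℂ) • 1).trace := by
      rw [trace_add, trace_add, hX.2, (hst t h0.le h1).2]
    rw [h3, sub_self] at hk
    have h4 : t * ((Y - X) * (mlog (Z + (ε : ℂ) • 1) - mlog ρ)).trace.re
        = ((Z + (ε : ℂ) • 1) * mlog (Z + (ε : ℂ) • 1)).trace.re
          - ((X + (ε : ℂ) • 1) * mlog (Z + (ε : ℂ) • 1)).trace.re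
          - ((Z * mlog ρ).trace.re - (X * mlog ρ).trace.re) := by
      have h5 : (t : ℂ) • (Y - X) = Z - X := by rw [hZ]; abel
      have h6 : (t : ℂ) * ((Y - X) * (mlog (Z + (ε : ℂ) • 1) - mlog ρ)).trace
          = ((Z - X) * (mlog (Z + (ε : ℂ) • 1) - mlog ρ)).trace := by
        rw [← h5, Matrix.smul_mul, trace_smul, smul_eq_mul]
      have h7 := congrArg Complex.re h6
      rw [Complex.re_ofReal_mul] at h7
      rw [h7]
      simp only [Matrix.sub_mul, Matrix.mul_sub, Matrix.add_mul, trace_sub, trace_add,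
        Complex.sub_re, Complex.add_re]
      ring
    simp only [shiftedEntropy] at h2
    simp only [Matrix.mul_sub, trace_sub, Complex.sub_re] at hk
    refine nonneg_of_mul_nonneg_right (a := t) ?_ h0
    rw [h4]
    linarith
  have hlim : Filter.Tendsto (fun t : ℝ =>
      ((Y - X) * (mlog (X + (t : ℂ) • (Y - X) + (ε : ℂ) • 1) - mlog ρ)).trace.re)
      (nhdsWithin 0 (Set.Ioc 0 1))
      (nhds ((Y - X) * (mlog (X + (ε : ℂ) • 1) - mlog ρ)).trace.re) := by
    have hp : ContinuousWithinAt (fun t : ℝ => X + (t : ℂ) • (Y - X)) (Set.Icc 0 1) 0 :=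
      (continuous_const.add (Complex.continuous_ofReal.smul continuous_const)).continuousWithinAt
    have hc : ContinuousWithinAt (fun t : ℝ => mlog (X + (t : ℂ) • (Y - X) + (ε : ℂ) • 1))
        (Set.Icc 0 1) 0 :=
      ContinuousWithinAt.comp (f := fun t : ℝ => X + (t : ℂ) • (Y - X))
        (g := fun Z => mlog (Z + (ε : ℂ) • 1)) (t := {Z | IsState Z})
        ((continuousOn_mlog_add_smul_one hε) _ (hst 0 le_rfl zero_le_one)) hp
        fun t ht => hst t ht.1 ht.2
    have hc2 : ContinuousWithinAt (fun t : ℝ =>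
        ((Y - X) * (mlog (X + (t : ℂ) • (Y - X) + (ε : ℂ) • 1) - mlog ρ)).trace.re)
        (Set.Icc 0 1) 0 :=
      (Complex.continuous_re.comp ((continuous_const.matrix_mul
        (continuous_id.sub continuous_const)).matrix_trace)).continuousAt.comp_continuousWithinAt
          (g := fun Z => ((Y - X) * (Z - mlog ρ)).trace.re) hc
    have := hc2.tendsto.mono_left (nhdsWithin_mono 0 Set.Ioc_subset_Icc_self)
    simpa using this
  have hne : (nhdsWithin (0 : ℝ) (Set.Ioc 0 1)).NeBot := by
    rw [nhdsWithin_Ioc_eq_nhdsGT zero_lt_one]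
    infer_instance
  have h0 := ge_of_tendsto hlim (Filter.eventually_of_mem self_mem_nhdsWithin
    fun t ht => key t ht.1 ht.2)
  rw [Matrix.sub_mul, trace_sub, Complex.sub_re] at h0
  linarith

end RelativeEntropy

/-! ### Minimization over extensions and its dual -/

section Duality

variable {A D F : Type*} [Fintype A] [Fintype D] [Fintype F] [DecidableEq A] [DecidableEq D]
  [DecidableEq F]

/-- The infimum of the relative entropy to `ρ_AD` over all extensions of `σ_AF` to `ADF`. -/
def extensionRec (σ : Matrix (A × F) (A × F) ℂ) (ρ : Matrix (A × D) (A × D) ℂ) : EReal :=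
  ⨅ (γ : Matrix ((A × D) × F) ((A × D) × F) ℂ) (_ : γ.PosSemidef ∧ ptraceMid γ = σ),
    relEntropy (ptraceRight γ) ρ

/-- The extensions of `σ_AF` to `ADF` whose marginal is supported on the support of `ρ_AD`. -/
def extensionsOn (σ : Matrix (A × F) (A × F) ℂ) (ρ : Matrix (A × D) (A × D) ℂ) :
    Set (Matrix ((A × D) × F) ((A × D) × F) ℂ) :=
  {γ | γ ∈ statesOn (suppProj ρ ⊗ₖ (1 : Matrix F F ℂ)) ∧ ptraceMid γ = σ}

variable {σ : Matrix (A × F) (A × F) ℂ} {ρ : Matrix (A × D) (A × D) ℂ}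

theorem isCompact_extensionsOn : IsCompact (extensionsOn σ ρ) :=
  (isCompact_statesOn _).inter_right (isClosed_eq continuous_ptraceMid continuous_const)

theorem suppProj_mul_ptraceRight_iff {γ : Matrix ((A × D) × F) ((A × D) × F) ℂ}
    (hγ : γ.PosSemidef) : suppProj ρ * ptraceRight γ = ptraceRight γ ↔
      (suppProj ρ ⊗ₖ (1 : Matrix F F ℂ)) * γ = γ :=
  mul_ptraceRight_eq_self_iff hγ (isHermitian_suppProj ρ) (suppProj_mul_self ρ)

theorem mem_extensionsOn (hσ : IsState σ) {γ : Matrix ((A × D) × F) ((A × D) × F) ℂ}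
    (hγ : γ.PosSemidef) (hγσ : ptraceMid γ = σ)
    (h : suppProj ρ * ptraceRight γ = ptraceRight γ) : γ ∈ extensionsOn σ ρ :=
  ⟨⟨⟨hγ, by rw [← trace_ptraceMid, hγσ, hσ.2]⟩, (suppProj_mul_ptraceRight_iff hγ).1 h⟩, hγσ⟩

theorem relEntropy_of_mem_extensionsOn (hρ : ρ.IsHermitian)
    {γ : Matrix ((A × D) × F) ((A × D) × F) ℂ} (hγ : γ ∈ extensionsOn σ ρ) :
    relEntropy (ptraceRight γ) ρ = ((shiftedEntropy ρ 0 (ptraceRight γ) : ℝ) : EReal) := by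
  rw [relEntropy_of_suppProj hρ ((suppProj_mul_ptraceRight_iff hγ.1.1.1).2 hγ.1.2),
    shiftedEntropy_zero]

theorem exists_isMinOn_shiftedEntropy (hne : (extensionsOn σ ρ).Nonempty) (ε : ℝ) :
    ∃ γ ∈ extensionsOn σ ρ, ∀ γ' ∈ extensionsOn σ ρ,
      shiftedEntropy ρ ε (ptraceRight γ) ≤ shiftedEntropy ρ ε (ptraceRight γ') := by
  obtain ⟨γ, hγ, hmin⟩ := isCompact_extensionsOn.exists_isMinOn hne
    ((continuousOn_shiftedEntropy ρ ε).comp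
      (continuous_ptraceRight (X := A × D) (Y := F)).continuousOn
      fun γ hγ => hγ.1.1.ptraceRight)
  exact ⟨γ, hγ, fun γ' hγ' => hmin hγ'⟩

/-- Tensoring with a pure state on `D` gives one. It serves as the minimizer when every value is
`+∞`. -/
theorem exists_extension [Nonempty D] (hσ : IsState σ) :
    ∃ γ : Matrix ((A × D) × F) ((A × D) × F) ℂ, γ.PosSemidef ∧ ptraceMid γ = σ := by
  obtain ⟨d₀⟩ := ‹Nonempty D›
  refine ⟨(σ ⊗ₖ vecMulVec (Pi.single d₀ 1) (star (Pi.single d₀ (1 : ℂ)))).submatrix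
    (fun x => ((x.1.1, x.2), x.1.2)) (fun x => ((x.1.1, x.2), x.1.2)),
    (hσ.1.kronecker (posSemidef_vecMulVec_self_star _)).submatrix _, ?_⟩
  ext p q
  simp [ptraceMid, vecMulVec_apply, Pi.single_apply]

/-- An extension of `σ_AF` with minimal relative entropy to `ρ_AD` exists. -/
theorem exists_eq_extensionRec [Nonempty D] (hσ : IsState σ) (hρ : ρ.IsHermitian) :
    ∃ γ : Matrix ((A × D) × F) ((A × D) × F) ℂ, (γ.PosSemidef ∧ ptraceMid γ = σ) ∧
      relEntropy (ptraceRight γ) ρ = extensionRec σ ρ := by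
  have hle : ∀ γ : Matrix ((A × D) × F) ((A × D) × F) ℂ, γ.PosSemidef ∧ ptraceMid γ = σ →
      extensionRec σ ρ ≤ relEntropy (ptraceRight γ) ρ := fun γ hγ => iInf₂_le γ hγ
  rcases (extensionsOn σ ρ).eq_empty_or_nonempty with hemp | hne
  · obtain ⟨γ, hγ⟩ := exists_extension (D := D) hσ
    refine ⟨γ, hγ, le_antisymm (le_iInf₂ fun γ' hγ' => ?_) (hle γ hγ)⟩
    rw [relEntropy_of_not_suppProj hρ (γ := ptraceRight γ')]
    · exact le_top
    · intro h
      exact (hemp ▸ mem_extensionsOn hσ hγ'.1 hγ'.2 h : γ' ∈ (∅ : Set _))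
  -- At `ε = 0` this is the relative entropy itself, still continuous because `x * log x` is
  -- continuous at zero.
  · obtain ⟨γ, hγ, hmin⟩ := exists_isMinOn_shiftedEntropy hne 0
    refine ⟨γ, ⟨hγ.1.1.1, hγ.2⟩, le_antisymm (le_iInf₂ fun γ' hγ' => ?_) (hle γ ⟨hγ.1.1.1, hγ.2⟩)⟩
    by_cases h : suppProj ρ * ptraceRight γ' = ptraceRight γ'
    · have hγ'' := mem_extensionsOn hσ hγ'.1 hγ'.2 h
      rw [relEntropy_of_mem_extensionsOn hρ hγ, relEntropy_of_mem_extensionsOn hρ hγ'',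
        EReal.coe_le_coe_iff]
      exact hmin γ' hγ''
    · rw [relEntropy_of_not_suppProj hρ h]
      exact le_top

/-- Weak duality. -/
theorem neg_trace_le_relEntropy (hσ : IsState σ) (hρ : ρ.IsHermitian)
    {R : Matrix (A × D) (A × D) ℂ} {S : Matrix (A × F) (A × F) ℂ} (hR : R.PosDef)
    (hR1 : R.trace = 1) (hS : DualConstraint ρ R S)
    {γ : Matrix ((A × D) × F) ((A × D) × F) ℂ} (hγ : γ.PosSemidef) (hγσ : ptraceMid γ = σ) :
    ((-(S * σ).trace.re : ℝ) : EReal) ≤ relEntropy (ptraceRight γ) ρ := by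
  by_cases h : suppProj ρ * ptraceRight γ = ptraceRight γ
  · have hγ' := mem_extensionsOn hσ hγ hγσ h
    rw [relEntropy_of_suppProj hρ h, EReal.coe_le_coe_iff]
    have h1 := (dualConstraint_iff hρ).1 hS γ hγ hγ'.1.2
    rw [← trace_ptraceRight_mul, ← trace_ptraceMid_mul, hγσ, Matrix.trace_mul_comm σ] at h1
    have h2 := klein (posSemidef_ptraceRight hγ) hR
    rw [hR1, hγ'.1.1.ptraceRight.2, sub_self] at h2
    simp only [Matrix.mul_sub, trace_sub, Complex.sub_re] at h1 h2 ⊢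
    linarith
  · rw [relEntropy_of_not_suppProj hρ h]
    exact le_top

theorem extensionsOn_segment {γ γ' : Matrix ((A × D) × F) ((A × D) × F) ℂ}
    (hγ : γ ∈ extensionsOn σ ρ) (hγ' : γ' ∈ extensionsOn σ ρ) {t : ℝ} (h0 : 0 ≤ t) (h1 : t ≤ 1) :
    ∃ γt ∈ extensionsOn σ ρ,
      ptraceRight γt = ptraceRight γ + (t : ℂ) • (ptraceRight γ' - ptraceRight γ) := by
  refine ⟨(1 - t) • γ + t • γ', ⟨convex_statesOn _ hγ.1 hγ'.1 (sub_nonneg.2 h1) h0 (by ring), ?_⟩, ?_⟩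
  -- Only the linearity of `ptraceMid`, the first component of `primalMap`, is needed.
  · have h2 := (primalMap (A := A) (D := D) (F := F) 0).map_add ((1 - t) • γ) (t • γ')
    rw [map_smul, map_smul] at h2
    have h3 : ptraceMid ((1 - t) • γ + t • γ') = (1 - t) • ptraceMid γ + t • ptraceMid γ' :=
      congrArg Prod.fst h2
    rw [h3, hγ.2, hγ'.2, ← add_smul, sub_add_cancel, one_smul]
  · ext x y
    simp [ptraceRight, Finset.sum_add_distrib, ← Finset.mul_sum]
    ring

/-- The operators `R_AD` of the dual problem suffice to approximate the optimal value. -/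
theorem exists_posDef_forall_lt [Nonempty (A × D)] (hρ : ρ.IsHermitian) {w : ℝ}
    (hw : (w : EReal) < extensionRec σ ρ) :
    ∃ R : Matrix (A × D) (A × D) ℂ, R.PosDef ∧ R.trace = 1 ∧ ∀ γ ∈ extensionsOn σ ρ,
      w < (ptraceRight γ * (mlog R - mlog ρ)).trace.re := by
  set d : ℝ := ((Fintype.card (A × D) : ℕ) : ℝ)
  have hd : 0 < d := Nat.cast_pos.2 Fintype.card_pos
  rcases (extensionsOn σ ρ).eq_empty_or_nonempty with hemp | hne
  · refine ⟨((d⁻¹ : ℝ) : ℂ) • 1, PosDef.one.smul (by exact_mod_cast inv_pos.2 hd), ?_, by simp [hemp]⟩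
    rw [trace_smul, trace_one, smul_eq_mul, ← Complex.ofReal_natCast, ← Complex.ofReal_mul,
      inv_mul_cancel₀ hd.ne', Complex.ofReal_one]
  obtain ⟨w', hw1, hw2⟩ := EReal.lt_iff_exists_real_btwn.1 hw
  rw [EReal.coe_lt_coe_iff] at hw1
  -- With this choice `X + ε1` has trace `exp (w' - w)`, so normalizing it costs exactly the margin
  -- `w' - w` between `w` and a value `w'` still below the infimum.
  set ε : ℝ := (Real.exp (w' - w) - 1) / d
  have hε : 0 < ε := div_pos (by linarith [Real.add_one_lt_exp (sub_pos.2 hw1).ne']) hd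
  obtain ⟨γ, hγ, hmin⟩ := exists_isMinOn_shiftedEntropy hne ε
  set X := ptraceRight γ
  have hX : IsState X := hγ.1.1.ptraceRight
  have hc : 1 + ε * d = Real.exp (w' - w) := by
    simp only [ε]
    field_simp
    ring
  have hexp := Real.exp_pos (w' - w)
  have hY := posDef_add_smul_one hX.1 hε
  refine ⟨((Real.exp (w' - w))⁻¹ : ℝ) • (X + (ε : ℂ) • 1), hY.smul (by positivity), ?_, ?_⟩
  · rw [trace_smul, trace_add, hX.2, trace_smul, trace_one, smul_eq_mul, ← Complex.ofReal_natCast,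
      ← Complex.ofReal_mul, ← Complex.ofReal_one, ← Complex.ofReal_add, hc, Complex.real_smul,
      ← Complex.ofReal_mul, inv_mul_cancel₀ hexp.ne']
  · intro γ' hγ'
    have hX' : IsState (ptraceRight γ') := hγ'.1.1.ptraceRight
    have h1 := trace_mul_le_of_forall_shiftedEntropy_le (ρ := ρ) hε hX hX' fun t h0 h1 => by
      obtain ⟨γt, hγt, he⟩ := extensionsOn_segment hγ hγ' h0.le h1
      rw [← he]
      exact hmin γt hγt
    have h2 := trace_mul_mlog_le hX.1 hε.le
    have h3 : (w' : EReal) < relEntropy X ρ := hw2.trans_le (iInf₂_le γ ⟨hγ.1.1.1, hγ.2⟩)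
    rw [relEntropy_of_mem_extensionsOn hρ hγ, EReal.coe_lt_coe_iff, shiftedEntropy_zero] at h3
    have h4 : ((Real.exp (w' - w))⁻¹ : ℝ) • (X + (ε : ℂ) • 1)
        = (((Real.exp (w' - w))⁻¹ : ℝ) : ℂ) • (X + (ε : ℂ) • (1 : Matrix (A × D) (A × D) ℂ)) := by
      ext i j
      simp only [Matrix.smul_apply, Complex.real_smul, smul_eq_mul]
    have h5 : (ptraceRight γ' * (((w - w' : ℝ) : ℂ) • 1)).trace.re = w - w' := by
      rw [Matrix.mul_smul, Matrix.mul_one, trace_smul, hX'.2]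
      simp
    rw [h4, mlog_smul hY (inv_pos.2 hexp), Real.log_inv, Real.log_exp, neg_sub]
    simp only [Matrix.mul_sub, Matrix.mul_add, trace_sub, trace_add, Complex.sub_re,
      Complex.add_re, h5] at h1 h3 ⊢
    change _ < (ptraceRight γ' * mlog (X + (ε : ℂ) • 1)).trace.re + (w - w') - _
    linarith

theorem isLUB_dualValues [Nonempty (A × D)] (hσ : IsState σ) (hρ : ρ.IsHermitian) :
    IsLUB (dualValues σ ρ) (extensionRec σ ρ) := by
  constructor
  · rintro _ ⟨R, S, hR, -, hS, hR1, rfl⟩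
    exact le_iInf₂ fun γ hγ => neg_trace_le_relEntropy hσ hρ hR hR1 hS hγ.1 hγ.2
  · intro b hb
    by_contra! hlt
    obtain ⟨w, hbw, hw⟩ := EReal.lt_iff_exists_real_btwn.1 hlt
    -- Once `R` is fixed, the remaining lower bound is linear in the extension, as linear duality
    -- requires.
    obtain ⟨R, hR, hR1, hRγ⟩ := exists_posDef_forall_lt hρ hw
    obtain ⟨S, hS, hSγ, hwS⟩ := exists_dual_feasible (D := D)
      (Q := suppProj ρ ⊗ₖ (1 : Matrix F F ℂ)) (H := (mlog ρ - mlog R) ⊗ₖ (1 : Matrix F F ℂ))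
      hσ (w := w) fun γ hγ hγσ => by
        have h := hRγ γ ⟨hγ, hγσ⟩
        rw [← trace_ptraceRight_mul]
        simp only [Matrix.mul_sub, trace_sub, Complex.sub_re] at h ⊢
        linarith
    have h1 := hb ⟨R, S, hR, hS, (dualConstraint_iff hρ).2 hSγ, hR1, rfl⟩
    have h2 : (w : EReal) < ((-(S * σ).trace.re : ℝ) : EReal) := EReal.coe_lt_coe_iff.2 hwS
    exact absurd (hbw.trans (h2.trans_le h1)) (lt_irrefl _)

end Duality

/-! ### Channels and extensions of the complementary marginal -/

section Channel

variable {E D : Type*} [Fintype E] [Fintype D]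

/-- The completely positive map with given Kraus operators. -/
def krausMap {κ : Type*} [Fintype κ] (K : κ → Matrix D E ℂ) :
    Matrix E E ℂ →ₗ[ℂ] Matrix D D ℂ where
  toFun X := ∑ k, K k * X * (K k)ᴴ
  map_add' X Y := by simp [Matrix.mul_add, Matrix.add_mul, Finset.sum_add_distrib]
  map_smul' r X := by simp [Finset.smul_sum]

theorem krausMap_apply {κ : Type*} [Fintype κ] (K : κ → Matrix D E ℂ) (X : Matrix E E ℂ) :
    krausMap K X = ∑ k, K k * X * (K k)ᴴ := rfl

theorem applyRight_krausMap {κ X : Type*} [Fintype κ] [Fintype X] [DecidableEq X]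
    (K : κ → Matrix D E ℂ) (M : Matrix (X × E) (X × E) ℂ) :
    applyRight (krausMap K) M
      = ∑ k, ((1 : Matrix X X ℂ) ⊗ₖ K k) * M * ((1 : Matrix X X ℂ) ⊗ₖ K k)ᴴ := by
  ext p q
  simp only [applyRight, krausMap_apply, of_apply, Matrix.sum_apply]
  refine Finset.sum_congr rfl fun k _ => ?_
  simp [Matrix.mul_apply, Fintype.sum_prod_type, one_apply, conjTranspose_kronecker,
    kroneckerMap_apply]

theorem isChannel_krausMap [DecidableEq E] {κ : Type*} [Fintype κ] {K : κ → Matrix D E ℂ}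
    (hK : ∑ k, (K k)ᴴ * K k = 1) : IsChannel (krausMap K) := by
  refine ⟨fun n M hM => ?_, fun X => ?_⟩
  · rw [applyRight_krausMap]
    exact posSemidef_sum _ fun k _ => hM.mul_mul_conjTranspose_same _
  · rw [krausMap_apply, trace_sum]
    simp only [fun k => Matrix.trace_mul_comm (K k * X) (K k)ᴴ, ← Matrix.mul_assoc]
    rw [← trace_sum, ← Finset.sum_mul, hK, Matrix.one_mul]

/-- Complete positivity is defined with reference systems `Fin n`; relabelling transfers it to any
finite one. -/
theorem IsChannel.posSemidef_applyRight {Γ : Matrix E E ℂ →ₗ[ℂ] Matrix D D ℂ} (hΓ : IsChannel Γ)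
    {X : Type*} [Fintype X] {M : Matrix (X × E) (X × E) ℂ} (hM : M.PosSemidef) :
    (applyRight Γ M).PosSemidef := by
  have e := Fintype.equivFin X
  have h := hΓ.1 _ _ (hM.submatrix (Prod.map e.symm id))
  have h2 := h.submatrix (Prod.map e id)
  have : applyRight Γ M = (applyRight Γ (M.submatrix (Prod.map e.symm id)
      (Prod.map e.symm id))).submatrix (Prod.map e id) (Prod.map e id) := by
    ext p q
    simp [applyRight]
  rwa [this]

/-- `Θ` and `Θᴴ * Θ` have the same kernel. -/
theorem mul_suppProj_conjTranspose_mul_self {m k : Type*} [Fintype m] [Fintype k] [DecidableEq k]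
    (Θ : Matrix m k ℂ) : Θ * suppProj (Θᴴ * Θ) = Θ := by
  have h : Θ * (1 - suppProj (Θᴴ * Θ)) = 0 := by
    rw [← conjTranspose_mul_self_mul_eq_zero, Matrix.mul_sub, Matrix.mul_one,
      mul_suppProj (isHermitian_conjTranspose_mul_self Θ), sub_self]
  rw [Matrix.mul_sub, Matrix.mul_one, sub_eq_zero] at h
  exact h.symm

/-- Two factorizations of the same positive operator are related by a partial isometry, which is
completed by `Q` to an isometry. -/
theorem exists_partial_isometry {m k : Type*} [Fintype m] [Fintype k] [DecidableEq k]
    [DecidableEq E] {Φ : Matrix m k ℂ} {Ψ : Matrix E k ℂ} (h : Φᴴ * Φ = Ψᴴ * Ψ) :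
    ∃ (W : Matrix m E ℂ) (Q : Matrix E E ℂ), W * Ψ = Φ ∧ Q * Ψ = 0 ∧ Wᴴ * W + Qᴴ * Q = 1 := by
  set N := Ψᴴ * Ψ with hN
  have hNh : N.IsHermitian := isHermitian_conjTranspose_mul_self Ψ
  -- `J` is the pseudoinverse of `Ψᴴ * Ψ`, so `P` below projects onto the range of `Ψ`. The partial
  -- isometry is `Φ * J * Ψᴴ`, and `Q` is the complementary projection.
  set J := cfc (fun x : ℝ => x⁻¹) N
  have hJ : Jᴴ = J := (isHermitian_cfc _ _).eq
  have hJNJ : J * N * J = J := by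
    rw [cfc_inv_mul hNh, suppProj, cfc_mul_cfc]
    simp only [J]
    congr 1
    ext x
    split_ifs with hx <;> simp [hx]
  set P := Ψ * J * Ψᴴ with hP
  have hPh : Pᴴ = P := by
    simp only [hP, conjTranspose_mul, conjTranspose_conjTranspose, hJ, Matrix.mul_assoc]
  have hPP : P * P = P := by
    calc P * P = Ψ * (J * N * J) * Ψᴴ := by simp only [hP, hN, Matrix.mul_assoc]
      _ = P := by rw [hJNJ]
  refine ⟨Φ * J * Ψᴴ, 1 - P, ?_, ?_, ?_⟩
  · rw [Matrix.mul_assoc, ← hN, Matrix.mul_assoc, cfc_inv_mul hNh, ← h, mul_suppProj_conjTranspose_mul_self]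
  · rw [Matrix.sub_mul, Matrix.one_mul, hP, Matrix.mul_assoc, ← hN, Matrix.mul_assoc,
      cfc_inv_mul hNh]
    rw [mul_suppProj_conjTranspose_mul_self, sub_self]
  · have h1 : (Φ * J * Ψᴴ)ᴴ * (Φ * J * Ψᴴ) = P := by
      calc (Φ * J * Ψᴴ)ᴴ * (Φ * J * Ψᴴ) = Ψ * (J * (Φᴴ * Φ) * J) * Ψᴴ := by
            simp only [conjTranspose_mul, conjTranspose_conjTranspose, hJ, Matrix.mul_assoc]
        _ = P := by rw [h, hJNJ]
    rw [h1, conjTranspose_sub, conjTranspose_one, hPh, Matrix.sub_mul, Matrix.mul_sub,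
      Matrix.mul_sub, hPP]
    simp

variable {A F : Type*} [Fintype A] [Fintype F] [DecidableEq A] [DecidableEq F] [DecidableEq D]

/-- A channel applied to a purification yields an extension of the complementary marginal. -/
theorem IsChannel.exists_extension {Γ : Matrix E E ℂ →ₗ[ℂ] Matrix D D ℂ} (hΓ : IsChannel Γ)
    (ψ : (A × E) × F → ℂ) :
    ∃ γ : Matrix ((A × D) × F) ((A × D) × F) ℂ, (γ.PosSemidef ∧ ptraceMid γ = marginalAF ψ) ∧
      ptraceRight γ = applyRight Γ (ptraceRight (pureState ψ)) := by
  have hψ : (pureState ψ).PosSemidef := posSemidef_vecMulVec_self_star ψ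
  -- The factors are reordered so that `Γ` acts on `E` with reference system `AF`, and `D` is then
  -- moved back between `A` and `F`.
  refine ⟨(applyRight Γ ((pureState ψ).submatrix (fun x : (A × F) × E => ((x.1.1, x.2), x.1.2))
    (fun x => ((x.1.1, x.2), x.1.2)))).submatrix (fun x => ((x.1.1, x.2), x.1.2))
    (fun x => ((x.1.1, x.2), x.1.2)), ⟨?_, ?_⟩, ?_⟩
  · exact (hΓ.posSemidef_applyRight (hψ.submatrix _)).submatrix _
  · ext p q
    exact hΓ.2 (Matrix.of fun e e' => pureState ψ ((p.1, e), p.2) ((q.1, e'), q.2))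
  · ext p q
    simp only [ptraceRight, applyRight, of_apply, submatrix_apply]
    have : (Matrix.of fun e e' => ∑ y, pureState ψ ((p.1, e), y) ((q.1, e'), y))
        = ∑ y, (Matrix.of fun e e' => pureState ψ ((p.1, e), y) ((q.1, e'), y)) := by
      ext e e'
      simp [Matrix.sum_apply]
    rw [this, map_sum, Matrix.sum_apply]

/-- Every extension of the complementary marginal arises from a channel. -/
theorem exists_isChannel [Nonempty D] {ψ : (A × E) × F → ℂ}
    {γ : Matrix ((A × D) × F) ((A × D) × F) ℂ} (hγ : γ.PosSemidef)
    (h : ptraceMid γ = marginalAF ψ) :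
    ∃ Γ : Matrix E E ℂ →ₗ[ℂ] Matrix D D ℂ, IsChannel Γ ∧
      applyRight Γ (ptraceRight (pureState ψ)) = ptraceRight γ := by
  classical
  obtain ⟨d₀⟩ := ‹Nonempty D›
  obtain ⟨B, rfl⟩ := exists_eq_conjTranspose_mul_self hγ
  -- The purification of `σ_AF` by `E`, and one of the same state by `D` together with an
  -- environment indexed by `ADF`, both reshaped as matrices. Each Gram matrix is the transpose of
  -- the common marginal on `AF`.
  set Ψ : Matrix E (A × F) ℂ := Matrix.of fun e p => ψ ((p.1, e), p.2) with hΨ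
  set Φ : Matrix (D × ((A × D) × F)) (A × F) ℂ :=
    Matrix.of fun x p => star (B x.2 ((p.1, x.1), p.2)) with hΦ
  have hΦΨ : Φᴴ * Φ = Ψᴴ * Ψ := by
    ext q p
    have h1 := congrFun (congrFun h p) q
    simp only [ptraceMid, marginalAF, of_apply, Matrix.mul_apply, pureState, vecMulVec_apply,
      conjTranspose_apply] at h1
    simp only [hΦ, hΨ, Matrix.mul_apply, conjTranspose_apply, of_apply, star_star,
      Fintype.sum_prod_type (α₁ := D)]
    simp only [mul_comm (B _ _), h1]
    exact Finset.sum_congr rfl fun e _ => mul_comm _ _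
  obtain ⟨W, Q, hW, hQ, hWQ⟩ := exists_partial_isometry hΦΨ
  -- The blocks of the partial isometry `W` over the environment are the Kraus operators that
  -- matter. The others send the complement of the range of `Ψ` to `d₀`: they make the map trace
  -- preserving and vanish on `ψ`.
  set K : ((A × D) × F) ⊕ E → Matrix D E ℂ := Sum.elim (fun g => Matrix.of fun d e => W (d, g) e)
    (fun e₀ => Matrix.of fun d e => if d = d₀ then Q e₀ e else 0) with hK
  refine ⟨krausMap K, isChannel_krausMap ?_, ?_⟩
  · rw [← hWQ]
    ext e e'
    simp only [Fintype.sum_sum_type, hK, Sum.elim_inl, Sum.elim_inr, Matrix.add_apply,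
      Matrix.sum_apply, Matrix.mul_apply, conjTranspose_apply, of_apply]
    congr 1
    · rw [Finset.sum_comm]
      exact (Fintype.sum_prod_type fun x => star (W x e) * W x e').symm
    · simp
  · have hKl : ∀ g d (p : A × F), ∑ e, K (Sum.inl g) d e * ψ ((p.1, e), p.2)
        = star (B g ((p.1, d), p.2)) := by
      intro g d p
      exact congrFun (congrFun hW (d, g)) p
    have hKr : ∀ e₀ d (p : A × F), ∑ e, K (Sum.inr e₀) d e * ψ ((p.1, e), p.2) = 0 := by
      intro e₀ d p
      have h0 : ∑ e, Q e₀ e * ψ ((p.1, e), p.2) = 0 := congrFun (congrFun hQ e₀) p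
      by_cases hd : d = d₀
      · simpa [hK, hd] using h0
      · simp [hK, hd]
    ext x y
    have key : ∀ k, (K k * (Matrix.of fun e e' => ptraceRight (pureState ψ) (x.1, e) (y.1, e'))
        * (K k)ᴴ) x.2 y.2 = ∑ f, (∑ e, K k x.2 e * ψ ((x.1, e), f))
          * star (∑ e, K k y.2 e * ψ ((y.1, e), f)) := by
      intro k
      have hm : (Matrix.of fun e e' => ptraceRight (pureState ψ) (x.1, e) (y.1, e'))
          = (Matrix.of fun e f => ψ ((x.1, e), f)) * (Matrix.of fun e f => ψ ((y.1, e), f))ᴴ := by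
        ext e e'
        simp [ptraceRight, pureState, vecMulVec_apply, Matrix.mul_apply]
      rw [hm, ← Matrix.mul_assoc, Matrix.mul_assoc, ← conjTranspose_mul, Matrix.mul_apply]
      rfl
    simp only [applyRight, krausMap_apply, of_apply, Matrix.sum_apply, key, Fintype.sum_sum_type]
    have hl := fun g d a f => hKl g d (a, f)
    have hr := fun g d a f => hKr g d (a, f)
    simp only at hl hr
    simp only [hl, hr, zero_mul, Finset.sum_const_zero, add_zero, star_star, ptraceRight, of_apply,
      Matrix.mul_apply, conjTranspose_apply]
    exact Finset.sum_comm

theorem flippedRec_eq_extensionRec [Nonempty D] {σ : Matrix (A × E) (A × E) ℂ}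
    {ψ : (A × E) × F → ℂ} (hψ : IsPurification ψ σ) (ρ : Matrix (A × D) (A × D) ℂ) :
    flippedRec σ ρ = extensionRec (marginalAF ψ) ρ := by
  obtain rfl : ptraceRight (pureState ψ) = σ := hψ
  refine le_antisymm (le_iInf₂ fun γ hγ => ?_) (le_iInf₂ fun Γ hΓ => ?_)
  · obtain ⟨Γ, hΓ, h⟩ := exists_isChannel hγ.1 hγ.2
    rw [← h]
    exact iInf₂_le Γ hΓ
  · obtain ⟨γ, hγ, h⟩ := hΓ.exists_extension ψ
    rw [← h]
    exact iInf₂_le γ hγ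

theorem exists_isPurification [DecidableEq E] {σ : Matrix (A × E) (A × E) ℂ}
    (hσ : σ.PosSemidef) : ∃ ψ : (A × E) × (A × E) → ℂ, IsPurification ψ σ := by
  obtain ⟨B, rfl⟩ := exists_eq_conjTranspose_mul_self hσ
  refine ⟨fun x => star (B x.2 x.1), ?_⟩
  ext x y
  simp [ptraceRight, pureState, vecMulVec_apply, Matrix.mul_apply]

theorem isState_marginalAF [DecidableEq E] {σ : Matrix (A × E) (A × E) ℂ} (hσ : IsState σ)
    {ψ : (A × E) × F → ℂ} (hψ : IsPurification ψ σ) : IsState (marginalAF ψ) := by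
  obtain rfl : ptraceRight (pureState ψ) = σ := hψ
  exact IsState.ptraceMid (D := E)
    ⟨posSemidef_vecMulVec_self_star ψ, by rw [← trace_ptraceRight, hσ.2]⟩

end Channel

/-! ### Tensor products of states, extensions and dual pairs -/

section Tensor

variable {A D A' D' : Type*}

theorem IsHermitian.tensor {M : Matrix (A × D) (A × D) ℂ} {N : Matrix (A' × D') (A' × D') ℂ}
    (hM : M.IsHermitian) (hN : N.IsHermitian) : (tensor M N).IsHermitian := by
  refine IsHermitian.submatrix ?_ _
  rw [IsHermitian, conjTranspose_kronecker, hM.eq, hN.eq]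

variable [Fintype A] [Fintype D] [Fintype A'] [Fintype D'] [DecidableEq A] [DecidableEq D]
  [DecidableEq A'] [DecidableEq D']

theorem tensor_mul_tensor (M₁ M₂ : Matrix (A × D) (A × D) ℂ)
    (N₁ N₂ : Matrix (A' × D') (A' × D') ℂ) :
    tensor M₁ N₁ * tensor M₂ N₂ = tensor (M₁ * M₂) (N₁ * N₂) := by
  rw [tensor, tensor, tensor, submatrix_mul_equiv, mul_kronecker_mul]

theorem trace_tensor (M : Matrix (A × D) (A × D) ℂ) (N : Matrix (A' × D') (A' × D') ℂ) :
    (tensor M N).trace = M.trace * N.trace := by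
  rw [← trace_kronecker, tensor, trace, trace]
  exact Equiv.sum_comp (Equiv.prodProdProdComm A A' D D') fun x => (M ⊗ₖ N) x x

theorem IsState.tensor {M : Matrix (A × D) (A × D) ℂ} {N : Matrix (A' × D') (A' × D') ℂ}
    (hM : IsState M) (hN : IsState N) : IsState (tensor M N) :=
  ⟨(hM.1.kronecker hN.1).submatrix _, by rw [trace_tensor, hM.2, hN.2, mul_one]⟩

theorem posDef_tensor {M : Matrix (A × D) (A × D) ℂ} {N : Matrix (A' × D') (A' × D') ℂ}
    (hM : M.PosDef) (hN : N.PosDef) : (tensor M N).PosDef :=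
  (hM.kronecker hN).submatrix (Equiv.injective _)

theorem isHermitian_kronecker {n m : Type*} {M : Matrix n n ℂ} {N : Matrix m m ℂ}
    (hM : M.IsHermitian) (hN : N.IsHermitian) : (M ⊗ₖ N).IsHermitian := by
  rw [IsHermitian, conjTranspose_kronecker, hM.eq, hN.eq]

theorem mlog_tensor {M : Matrix (A × D) (A × D) ℂ} {N : Matrix (A' × D') (A' × D') ℂ}
    (hM : M.IsHermitian) (hN : N.IsHermitian) :
    mlog (tensor M N) = tensor (mlog M) (suppProj N) + tensor (suppProj M) (mlog N) := by
  have h := mlog_kronecker hM hN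
  rw [mlog] at h ⊢
  rw [tensor, cfc_submatrix_equiv (isHermitian_kronecker hM hN), h, submatrix_add]
  rfl

theorem suppProj_tensor {M : Matrix (A × D) (A × D) ℂ} {N : Matrix (A' × D') (A' × D') ℂ}
    (hM : M.IsHermitian) (hN : N.IsHermitian) :
    suppProj (tensor M N) = tensor (suppProj M) (suppProj N) := by
  have h := suppProj_kronecker hM hN
  rw [suppProj] at h ⊢
  rw [tensor, cfc_submatrix_equiv (isHermitian_kronecker hM hN), h]
  rfl

/-- Additivity of the relative entropy under tensor products, in the finite case. -/
theorem relEntropy_tensor {γ ρ : Matrix (A × D) (A × D) ℂ} {γ' τ : Matrix (A' × D') (A' × D') ℂ}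
    (hγ : IsState γ) (hγ' : IsState γ') (hρ : ρ.IsHermitian) (hτ : τ.IsHermitian)
    (h : suppProj ρ * γ = γ) (h' : suppProj τ * γ' = γ') :
    relEntropy (tensor γ γ') (tensor ρ τ) = relEntropy γ ρ + relEntropy γ' τ := by
  have hs : suppProj (tensor ρ τ) * tensor γ γ' = tensor γ γ' := by
    rw [suppProj_tensor hρ hτ, tensor_mul_tensor, h, h']
  have hr : γ * suppProj ρ = γ := by
    have := congrArg conjTranspose h
    rwa [conjTranspose_mul, hγ.1.isHermitian.eq, (isHermitian_suppProj ρ).eq] at this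
  have hr' : γ' * suppProj τ = γ' := by
    have := congrArg conjTranspose h'
    rwa [conjTranspose_mul, hγ'.1.isHermitian.eq, (isHermitian_suppProj τ).eq] at this
  rw [relEntropy_of_suppProj (IsHermitian.tensor hρ hτ) hs, relEntropy_of_suppProj hρ h,
    relEntropy_of_suppProj hτ h', ← EReal.coe_add, mlog_tensor hρ hτ,
    mlog_tensor hγ.1.isHermitian hγ'.1.isHermitian]
  congr 1
  simp only [Matrix.mul_sub, Matrix.mul_add, tensor_mul_tensor, trace_sub, trace_add, trace_tensor,
    mul_suppProj hγ.1.isHermitian, mul_suppProj hγ'.1.isHermitian, hr, hr', hγ.2, hγ'.2, mul_one,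
    one_mul, Complex.sub_re, Complex.add_re]
  ring

variable {F F' : Type*} [Fintype F] [Fintype F'] [DecidableEq F] [DecidableEq F']

/-- The reordering of six tensor factors. -/
def tripleComm (A A' D D' F F' : Type*) :
    ((A × A') × (D × D')) × (F × F') ≃ ((A × D) × F) × ((A' × D') × F') :=
  ((Equiv.prodProdProdComm A A' D D').prodCongr (Equiv.refl _)).trans
    (Equiv.prodProdProdComm (A × D) (A' × D') F F')

/-- The tensor product of operators on tripartite systems. -/
def tensorTriple (γ : Matrix ((A × D) × F) ((A × D) × F) ℂ)
    (γ' : Matrix ((A' × D') × F') ((A' × D') × F') ℂ) :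
    Matrix (((A × A') × (D × D')) × (F × F')) (((A × A') × (D × D')) × (F × F')) ℂ :=
  (γ ⊗ₖ γ').submatrix (tripleComm A A' D D' F F') (tripleComm A A' D D' F F')

theorem tensorTriple_apply (γ : Matrix ((A × D) × F) ((A × D) × F) ℂ)
    (γ' : Matrix ((A' × D') × F') ((A' × D') × F') ℂ) (x y) :
    tensorTriple γ γ' x y
      = γ ((x.1.1.1, x.1.2.1), x.2.1) ((y.1.1.1, y.1.2.1), y.2.1)
        * γ' ((x.1.1.2, x.1.2.2), x.2.2) ((y.1.1.2, y.1.2.2), y.2.2) := rfl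

theorem tensor_apply (M : Matrix (A × D) (A × D) ℂ) (N : Matrix (A' × D') (A' × D') ℂ) (x y) :
    tensor M N x y = M (x.1.1, x.2.1) (y.1.1, y.2.1) * N (x.1.2, x.2.2) (y.1.2, y.2.2) := rfl

theorem posSemidef_tensorTriple {γ : Matrix ((A × D) × F) ((A × D) × F) ℂ}
    {γ' : Matrix ((A' × D') × F') ((A' × D') × F') ℂ} (h : γ.PosSemidef) (h' : γ'.PosSemidef) :
    (tensorTriple γ γ').PosSemidef := (h.kronecker h').submatrix _

theorem tensorTriple_mul_tensorTriple (γ₁ γ₂ : Matrix ((A × D) × F) ((A × D) × F) ℂ)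
    (γ₁' γ₂' : Matrix ((A' × D') × F') ((A' × D') × F') ℂ) :
    tensorTriple γ₁ γ₁' * tensorTriple γ₂ γ₂' = tensorTriple (γ₁ * γ₂) (γ₁' * γ₂') := by
  rw [tensorTriple, tensorTriple, tensorTriple, submatrix_mul_equiv, mul_kronecker_mul]

theorem ptraceRight_tensorTriple (γ : Matrix ((A × D) × F) ((A × D) × F) ℂ)
    (γ' : Matrix ((A' × D') × F') ((A' × D') × F') ℂ) :
    ptraceRight (tensorTriple γ γ') = tensor (ptraceRight γ) (ptraceRight γ') := by
  ext x y
  simp only [ptraceRight, of_apply, tensorTriple_apply, tensor_apply, Fintype.sum_prod_type,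
    Finset.sum_mul_sum]

theorem ptraceMid_tensorTriple (γ : Matrix ((A × D) × F) ((A × D) × F) ℂ)
    (γ' : Matrix ((A' × D') × F') ((A' × D') × F') ℂ) :
    ptraceMid (tensorTriple γ γ') = tensor (ptraceMid γ) (ptraceMid γ') := by
  ext x y
  simp only [ptraceMid, of_apply, tensorTriple_apply, tensor_apply, Fintype.sum_prod_type,
    Finset.sum_mul_sum]

theorem oneTensor_tensor (S : Matrix (A × F) (A × F) ℂ) (S' : Matrix (A' × F') (A' × F') ℂ) :
    oneTensor (D := D × D') (tensor S S') = tensorTriple (oneTensor S) (oneTensor S') := by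
  ext x y
  simp only [oneTensor, of_apply, tensorTriple_apply, tensor_apply, Prod.ext_iff]
  by_cases h1 : x.1.2.1 = y.1.2.1 <;> by_cases h2 : x.1.2.2 = y.1.2.2 <;> simp [h1, h2]

theorem oneTensor_one : oneTensor (D := D) (1 : Matrix (A × F) (A × F) ℂ) = 1 := by
  ext x y
  obtain ⟨⟨a, d⟩, f⟩ := x
  obtain ⟨⟨a', d'⟩, f'⟩ := y
  by_cases h : d = d' <;> simp [oneTensor, one_apply, h]

theorem oneTensor_add (S T : Matrix (A × F) (A × F) ℂ) :
    oneTensor (D := D) (S + T) = oneTensor S + oneTensor T := by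
  ext x y
  by_cases h : x.1.2 = y.1.2 <;> simp [oneTensor, h]

theorem tensor_kronecker_one (M : Matrix (A × D) (A × D) ℂ) (N : Matrix (A' × D') (A' × D') ℂ) :
    tensor M N ⊗ₖ (1 : Matrix (F × F') (F × F') ℂ)
      = tensorTriple (M ⊗ₖ (1 : Matrix F F ℂ)) (N ⊗ₖ (1 : Matrix F' F' ℂ)) := by
  ext x y
  simp only [kroneckerMap_apply, tensorTriple_apply, tensor_apply, one_apply, Prod.ext_iff]
  by_cases h1 : x.2.1 = y.2.1 <;> by_cases h2 : x.2.2 = y.2.2 <;> simp [h1, h2]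

/-- An inequality that holds on a subsystem holds on the whole system. -/
theorem trace_mul_submatrix_le {X Y Z : Type*} [Fintype X] [Fintype Y] [Fintype Z] [DecidableEq X]
    [DecidableEq Y] [DecidableEq Z] (e : Z ≃ X × Y) {Q H T : Matrix X X ℂ}
    (h : ∀ δ : Matrix X X ℂ, δ.PosSemidef → Q * δ = δ → (δ * H).trace.re ≤ (δ * T).trace.re)
    {γ : Matrix Z Z ℂ} (hγ : γ.PosSemidef)
    (hQ : (Q ⊗ₖ (1 : Matrix Y Y ℂ)).submatrix e e * γ = γ) :
    (γ * (H ⊗ₖ (1 : Matrix Y Y ℂ)).submatrix e e).trace.re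
      ≤ (γ * (T ⊗ₖ (1 : Matrix Y Y ℂ)).submatrix e e).trace.re := by
  -- After relabelling, the hypothesis is applied to the marginal on `X`, which inherits the support
  -- condition.
  obtain ⟨δ, rfl⟩ : ∃ δ : Matrix (X × Y) (X × Y) ℂ, γ = δ.submatrix e e :=
    ⟨γ.submatrix e.symm e.symm, by simp⟩
  have htr : ∀ M : Matrix (X × Y) (X × Y) ℂ, (M.submatrix e e).trace = M.trace :=
    fun M => Equiv.sum_comp e fun x => M x x
  rw [submatrix_mul_equiv] at hQ ⊢
  rw [submatrix_mul_equiv, htr, htr, ← trace_ptraceRight_mul, ← trace_ptraceRight_mul]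
  have hδ : δ.PosSemidef := (posSemidef_submatrix_equiv e).1 hγ
  refine h _ (posSemidef_ptraceRight hδ) ?_
  rw [mul_ptraceRight]
  congr 1
  have := congrArg (fun M => M.submatrix e.symm e.symm) hQ
  simpa using this

/-- Dual feasible pairs of two problems combine to a dual feasible pair of the product. -/
theorem DualConstraint.tensor {ρ R : Matrix (A × D) (A × D) ℂ} {S : Matrix (A × F) (A × F) ℂ}
    {τ R' : Matrix (A' × D') (A' × D') ℂ} {S' : Matrix (A' × F') (A' × F') ℂ}
    (hρ : ρ.IsHermitian) (hτ : τ.IsHermitian) (hR : R.PosDef) (hR' : R'.PosDef)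
    (h : DualConstraint ρ R S) (h' : DualConstraint τ R' S') :
    DualConstraint (QRec.tensor ρ τ) (QRec.tensor R R')
      (QRec.tensor S 1 + QRec.tensor 1 S') := by
  rw [dualConstraint_iff (IsHermitian.tensor hρ hτ)]
  intro γ hγ hQ
  have hlogR : mlog (QRec.tensor R R') = QRec.tensor (mlog R) 1 + QRec.tensor 1 (mlog R') := by
    rw [mlog_tensor hR.isHermitian hR'.isHermitian, suppProj_eq_one hR, suppProj_eq_one hR']
  -- The logarithm of a singular product is the sum of the local logarithms only on the support.
  -- Since `γ` lives there, `hdrop` removes the projection under the trace.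
  have hlogρ : mlog (QRec.tensor ρ τ) = (QRec.tensor (mlog ρ) 1 + QRec.tensor 1 (mlog τ))
      * suppProj (QRec.tensor ρ τ) := by
    rw [mlog_tensor hρ hτ, suppProj_tensor hρ hτ, Matrix.add_mul, tensor_mul_tensor,
      tensor_mul_tensor, mlog_mul_suppProj, mlog_mul_suppProj, Matrix.one_mul, Matrix.one_mul]
  have hdrop : ∀ M : Matrix ((A × A') × (D × D')) ((A × A') × (D × D')) ℂ,
      (γ * ((M * suppProj (QRec.tensor ρ τ)) ⊗ₖ (1 : Matrix (F × F') (F × F') ℂ))).trace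
        = (γ * (M ⊗ₖ (1 : Matrix (F × F') (F × F') ℂ))).trace := by
    intro M
    rw [← kronecker_one_mul_kronecker_one, ← Matrix.mul_assoc, Matrix.trace_mul_comm,
      ← Matrix.mul_assoc, hQ]
  rw [suppProj_tensor hρ hτ, tensor_kronecker_one] at hQ
  have hQ1 : tensorTriple (suppProj ρ ⊗ₖ (1 : Matrix F F ℂ))
      (1 : Matrix ((A' × D') × F') ((A' × D') × F') ℂ) * γ = γ := by
    conv_lhs => rw [← hQ]
    rw [← Matrix.mul_assoc, tensorTriple_mul_tensorTriple, kronecker_one_mul_kronecker_one,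
      suppProj_mul_self, Matrix.one_mul, hQ]
  have hQ2 : tensorTriple (1 : Matrix ((A × D) × F) ((A × D) × F) ℂ)
      (suppProj τ ⊗ₖ (1 : Matrix F' F' ℂ)) * γ = γ := by
    conv_lhs => rw [← hQ]
    rw [← Matrix.mul_assoc, tensorTriple_mul_tensorTriple, kronecker_one_mul_kronecker_one,
      suppProj_mul_self, Matrix.one_mul, hQ]
  have hswap : ∀ M : Matrix ((A' × D') × F') ((A' × D') × F') ℂ,
      tensorTriple (1 : Matrix ((A × D) × F) ((A × D) × F) ℂ) M
        = (M ⊗ₖ (1 : Matrix ((A × D) × F) ((A × D) × F) ℂ)).submatrix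
          ((tripleComm A A' D D' F F').trans (Equiv.prodComm _ _))
          ((tripleComm A A' D D' F F').trans (Equiv.prodComm _ _)) := by
    intro M
    ext x y
    exact mul_comm _ _
  have b1 := trace_mul_submatrix_le (tripleComm A A' D D' F F')
    ((dualConstraint_iff hρ).1 h) hγ hQ1
  have b2 := trace_mul_submatrix_le
    ((tripleComm A A' D D' F F').trans (Equiv.prodComm _ _))
    ((dualConstraint_iff hτ).1 h') hγ (by rw [← hswap]; exact hQ2)
  rw [← hswap, ← hswap] at b2
  change (γ * tensorTriple _ 1).trace.re ≤ (γ * tensorTriple _ 1).trace.re at b1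
  have e1 : (γ * ((mlog (QRec.tensor ρ τ) - mlog (QRec.tensor R R'))
      ⊗ₖ (1 : Matrix (F × F') (F × F') ℂ))).trace
        = (γ * tensorTriple ((mlog ρ - mlog R) ⊗ₖ (1 : Matrix F F ℂ)) 1).trace
          + (γ * tensorTriple 1 ((mlog τ - mlog R') ⊗ₖ (1 : Matrix F' F' ℂ))).trace := by
    have k1 : tensorTriple ((mlog ρ - mlog R) ⊗ₖ (1 : Matrix F F ℂ))
        (1 : Matrix ((A' × D') × F') ((A' × D') × F') ℂ)
          = QRec.tensor (mlog ρ) 1 ⊗ₖ 1 - QRec.tensor (mlog R) 1 ⊗ₖ 1 := by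
      rw [tensor_kronecker_one, tensor_kronecker_one, one_kronecker_one]
      ext x y
      simp only [tensorTriple_apply, Matrix.sub_apply, kroneckerMap_apply, sub_mul]
    have k2 : tensorTriple (1 : Matrix ((A × D) × F) ((A × D) × F) ℂ)
        ((mlog τ - mlog R') ⊗ₖ (1 : Matrix F' F' ℂ))
          = QRec.tensor 1 (mlog τ) ⊗ₖ 1 - QRec.tensor 1 (mlog R') ⊗ₖ 1 := by
      rw [tensor_kronecker_one, tensor_kronecker_one, one_kronecker_one]
      ext x y
      simp only [tensorTriple_apply, Matrix.sub_apply, kroneckerMap_apply, sub_mul, mul_sub]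
    have hsub : ∀ M N : Matrix ((A × A') × (D × D')) ((A × A') × (D × D')) ℂ,
        (M - N) ⊗ₖ (1 : Matrix (F × F') (F × F') ℂ) = M ⊗ₖ 1 - N ⊗ₖ 1 := by
      intro M N
      ext x y
      simp only [Matrix.sub_apply, kroneckerMap_apply, sub_mul]
    rw [hsub, Matrix.mul_sub, trace_sub, hlogρ, hdrop, hlogR, k1, k2, add_kronecker,
      add_kronecker]
    simp only [Matrix.mul_add, Matrix.mul_sub, trace_add, trace_sub]
    ring
  rw [e1, oneTensor_add, oneTensor_tensor, oneTensor_tensor, oneTensor_one, oneTensor_one,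
    Matrix.mul_add, trace_add, Complex.add_re, Complex.add_re]
  exact add_le_add b1 b2

end Tensor

/-! ### Additivity and product purifications -/

section Additivity

variable {A D F A' D' F' : Type*} [Fintype A] [Fintype D] [Fintype F] [DecidableEq A]
  [DecidableEq D] [DecidableEq F] [Fintype A'] [Fintype D'] [Fintype F'] [DecidableEq A']
  [DecidableEq D'] [DecidableEq F']

/-- Rules out the sum `⊤ + ⊥` in `EReal`, so that an infinite summand makes the right side of
additivity infinite. -/
theorem extensionRec_ne_bot {σ : Matrix (A × F) (A × F) ℂ} {ρ : Matrix (A × D) (A × D) ℂ}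
    [Nonempty (A × D)] (hσ : IsState σ) (hρ : ρ.IsHermitian) : extensionRec σ ρ ≠ ⊥ := by
  have : Nonempty D := (‹Nonempty (A × D)›).map Prod.snd
  obtain ⟨γ, -, h⟩ := exists_eq_extensionRec (D := D) hσ hρ
  rw [← h, relEntropy]
  split_ifs
  · exact EReal.coe_ne_bot _
  · exact top_ne_bot

theorem extensionRec_tensor {σ : Matrix (A × F) (A × F) ℂ} {ρ : Matrix (A × D) (A × D) ℂ}
    {ω : Matrix (A' × F') (A' × F') ℂ} {τ : Matrix (A' × D') (A' × D') ℂ} (hσ : IsState σ)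
    (hω : IsState ω) (hρ : ρ.IsHermitian) (hτ : τ.IsHermitian) [Nonempty (A × D)]
    [Nonempty (A' × D')] :
    extensionRec (tensor σ ω) (tensor ρ τ) = extensionRec σ ρ + extensionRec ω τ := by
  have : Nonempty D := (‹Nonempty (A × D)›).map Prod.snd
  have : Nonempty D' := (‹Nonempty (A' × D')›).map Prod.snd
  have : Nonempty ((A × A') × (D × D')) :=
    (‹Nonempty (A × D)›).elim fun x => (‹Nonempty (A' × D')›).map fun y => ((x.1, y.1), (x.2, y.2))
  have lub := isLUB_dualValues (D := D) hσ hρ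
  have lub' := isLUB_dualValues (D := D') hω hτ
  have lub'' := isLUB_dualValues (hσ.tensor hω) (IsHermitian.tensor hρ hτ)
  refine le_antisymm ?_ ?_
  · obtain ⟨γ, ⟨hγ, hγσ⟩, hmin⟩ := exists_eq_extensionRec (D := D) hσ hρ
    obtain ⟨γ', ⟨hγ', hγω⟩, hmin'⟩ := exists_eq_extensionRec (D := D') hω hτ
    by_cases h : suppProj ρ * ptraceRight γ = ptraceRight γ
    · by_cases h' : suppProj τ * ptraceRight γ' = ptraceRight γ'
      · have hst : IsState (ptraceRight γ) := (mem_extensionsOn hσ hγ hγσ h).1.1.ptraceRight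
        have hst' : IsState (ptraceRight γ') := (mem_extensionsOn hω hγ' hγω h').1.1.ptraceRight
        rw [← hmin, ← hmin', ← relEntropy_tensor hst hst' hρ hτ h h', ← ptraceRight_tensorTriple]
        refine iInf₂_le (tensorTriple γ γ') ⟨posSemidef_tensorTriple hγ hγ', ?_⟩
        rw [ptraceMid_tensorTriple, hγσ, hγω]
      · rw [← hmin', relEntropy_of_not_suppProj hτ h',
          EReal.add_top_of_ne_bot (extensionRec_ne_bot hσ hρ)]
        exact le_top
    · rw [← hmin, relEntropy_of_not_suppProj hρ h,
        EReal.top_add_of_ne_bot (extensionRec_ne_bot hω hτ)]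
      exact le_top
  -- Superadditivity uses dual pairs approximating each supremum. Their combination has the sum of
  -- the two objective values because both marginals have trace one.
  · refine EReal.add_le_of_forall_lt fun a ha b hb => ?_
    obtain ⟨_, ⟨R, S, hR, hS, hRS, hR1, rfl⟩, hx⟩ := (lt_isLUB_iff lub).1 ha
    obtain ⟨_, ⟨R', S', hR', hS', hRS', hR1', rfl⟩, hy⟩ := (lt_isLUB_iff lub').1 hb
    refine (add_le_add hx.le hy.le).trans (lub''.1 ⟨tensor R R', tensor S 1 + tensor 1 S',
      posDef_tensor hR hR', (IsHermitian.tensor hS isHermitian_one).add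
        (IsHermitian.tensor isHermitian_one hS'), hRS.tensor hρ hτ hR hR' hRS', ?_, ?_⟩)
    · rw [trace_tensor, hR1, hR1', mul_one]
    · rw [← EReal.coe_add, Matrix.add_mul, tensor_mul_tensor, tensor_mul_tensor, trace_add,
        trace_tensor, trace_tensor, Matrix.one_mul, Matrix.one_mul, hσ.2, hω.2, mul_one, one_mul,
        Complex.add_re, neg_add]

variable {E E' : Type*} [Fintype E] [Fintype E']

/-- The tensor product of two purifications. -/
def tensorVec (ψ : (A × E) × F → ℂ) (φ : (A' × E') × F' → ℂ) :
    ((A × A') × (E × E')) × (F × F') → ℂ :=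
  fun x => ψ ((x.1.1.1, x.1.2.1), x.2.1) * φ ((x.1.1.2, x.1.2.2), x.2.2)

theorem pureState_tensorVec (ψ : (A × E) × F → ℂ) (φ : (A' × E') × F' → ℂ) :
    pureState (tensorVec ψ φ) = tensorTriple (pureState ψ) (pureState φ) := by
  ext x y
  simp only [pureState, vecMulVec_apply, tensorVec, tensorTriple_apply, Pi.star_apply, star_mul']
  ring

theorem IsPurification.tensorVec [DecidableEq E] [DecidableEq E'] {ψ : (A × E) × F → ℂ}
    {φ : (A' × E') × F' → ℂ} {σ : Matrix (A × E) (A × E) ℂ} {ω : Matrix (A' × E') (A' × E') ℂ}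
    (h : IsPurification ψ σ) (h' : IsPurification φ ω) :
    IsPurification (tensorVec ψ φ) (tensor σ ω) := by
  rw [IsPurification, pureState_tensorVec, ptraceRight_tensorTriple, h, h']

theorem marginalAF_tensorVec [DecidableEq E] [DecidableEq E'] (ψ : (A × E) × F → ℂ)
    (φ : (A' × E') × F' → ℂ) :
    marginalAF (tensorVec ψ φ) = tensor (marginalAF ψ) (marginalAF φ) := by
  change ptraceMid (pureState (tensorVec ψ φ)) = _
  rw [pureState_tensorVec, ptraceMid_tensorTriple]
  rfl

end Additivity

theorem nonempty_of_isState {X : Type*} [Fintype X] {ρ : Matrix X X ℂ} (hρ : IsState ρ) :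
    Nonempty X := by
  by_contra h
  rw [not_nonempty_iff] at h
  have := hρ.2
  simp [trace] at this

end

end QRec

theorem proposition8
    {A D E F : Type*} [Fintype A] [Fintype D] [Fintype E] [Fintype F]
    [DecidableEq A] [DecidableEq D] [DecidableEq F]
    {A' D' E' : Type*} [Fintype A'] [Fintype D'] [Fintype E']
    [DecidableEq A'] [DecidableEq D']
    (ρ : Matrix (A × D) (A × D) ℂ) (hρ : QRec.IsState ρ) (hρA : (QRec.ptraceRight ρ).PosDef)
    (σ : Matrix (A × E) (A × E) ℂ) (hσ : QRec.IsState σ) :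
    (∃ Γ : Matrix E E ℂ →ₗ[ℂ] Matrix D D ℂ, QRec.IsChannel Γ ∧
      QRec.relEntropy (QRec.applyRight Γ σ) ρ = QRec.flippedRec σ ρ) ∧
    (∀ ψ : (A × E) × F → ℂ, QRec.IsPurification ψ σ →
      IsLUB (QRec.dualValues (QRec.marginalAF ψ) ρ) (QRec.flippedRec σ ρ)) ∧
    (∀ (τ : Matrix (A' × D') (A' × D') ℂ) (ω : Matrix (A' × E') (A' × E') ℂ),
      QRec.IsState τ → (QRec.ptraceRight τ).PosDef → QRec.IsState ω →
      QRec.flippedRec (QRec.tensor σ ω) (QRec.tensor ρ τ)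
        = QRec.flippedRec σ ρ + QRec.flippedRec ω τ) := by
  classical
  have := QRec.nonempty_of_isState hρ
  have : Nonempty D := (‹Nonempty (A × D)›).map Prod.snd
  have hρh := hρ.1.isHermitian
  obtain ⟨ψ, hψ⟩ := QRec.exists_isPurification hσ.1
  refine ⟨?_, ?_, ?_⟩
  · obtain ⟨γ, ⟨hγ, hγσ⟩, hmin⟩ :=
      QRec.exists_eq_extensionRec (D := D) (QRec.isState_marginalAF hσ hψ) hρh
    obtain ⟨Γ, hΓ, h⟩ := QRec.exists_isChannel hγ hγσ
    refine ⟨Γ, hΓ, ?_⟩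
    rw [QRec.flippedRec_eq_extensionRec hψ, ← hmin, ← h, show QRec.ptraceRight _ = σ from hψ]
  · intro φ hφ
    rw [QRec.flippedRec_eq_extensionRec hφ]
    exact QRec.isLUB_dualValues (QRec.isState_marginalAF hσ hφ) hρh
  · intro τ ω hτ _ hω
    have := QRec.nonempty_of_isState hτ
    have : Nonempty D' := (‹Nonempty (A' × D')›).map Prod.snd
    obtain ⟨φ, hφ⟩ := QRec.exists_isPurification hω.1
    rw [QRec.flippedRec_eq_extensionRec hψ, QRec.flippedRec_eq_extensionRec hφ,
      QRec.flippedRec_eq_extensionRec (hψ.tensorVec hφ), QRec.marginalAF_tensorVec]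
    exact QRec.extensionRec_tensor (QRec.isState_marginalAF hσ hψ)
      (QRec.isState_marginalAF hω hφ) hρh hτ.1.isHermitian
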